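/- Let $G=(V,E)$ be a finite simple undirected graph with at least one edge and positive edge weights, $n=|V|$, $m=|E|$, and let $w$ be its tree-width (the least possible value of the largest bag size minus one over all tree decompositions). **Rankings.** A centroid decomposition of a tree puts a centroid $c$ of the tree at depth $0$ (a node such that every component of the tree without $c$ has at most half of the nodes) and continues recursively, one level deeper, in each of these components. Fix $K\in\mathbb N$. A *centroid ranking* is an injective map $R:V\to\mathbb N$ (larger means ranked higher) for which there are a tree decomposition of $G$ of minimum width $w$ with at most $n^K$ nodes and a centroid decomposition of its tree such that $R(v)<R(u)$ whenever the least depth of a bag containing $u$ is smaller than the least depth of a bag containing $v$ (ties are broken arbitrarily). **Algorithms.** Every vertex $v$ has a list $L_v$ of labels (hub, distance), initially empty. A *pruned Dijkstra search* from a root $h$ hashes $L_h$ and runs Dijkstra's algorithm from $h$; when a vertex $v$ is popped with tentative distance $\delta$, the search is pruned at $v$ if a *distance query* (a scan of $L_v$ for an $(h',d)\in L_v$ with $(h',d')$ in the hashed $L_h$ and $d+d'\le\delta$) succeeds; otherwise $(h,\delta)$ is added to $L_v$ and the edges at $v$ are relaxed. *Sequential PLL* runs these searches one after another in the order of decreasing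 rank. *LCC* with $p$ threads, $1\le p\le n$, works as follows. (I) Each thread repeatedly takes the highest ranked vertex that has not been taken yet and runs a pruned Dijkstra search from it, which is in addition pruned (before the distance query) at every popped vertex that is ranked higher than the root; the atomic steps of the threads are interleaved arbitrarily. (II) All $L_v$ are sorted by decreasing rank of the hub, and then, for all $v$ concurrently, each $(h,\delta)\in L_v$ is deleted if the highest ranked common hub $u$ of $L_v$ and $L_h$ with total distance at most $\delta$ exists and has $R(u)>R(h)$ (found by merging the two sorted lists). A *query* $(u,v)$ merges the final lists $L_u$ and $L_v$ and returns the least total distance over common hubs ($\infty$ if there is none). **Work** is the total number of steps of all threads, where arithmetic, comparisons and array or hash-table accesses are unit steps, an operation on a priority queue with $q$ entries costs $1+\lfloor\log_2 q\rfloor$ and sorting $k$ entries costs $k(1+\lfloor\log_2 k\rfloor)$. **Claim.** For every $K$ there is a constant $C>0$ that depends only on $K$ such that the following holds for all such $G$. A centroid ranking exists, even one from a decomposition with at most $n$ nodes. For every centroid ranking $R$ (with at most $n^K$ nodes), every $1\le p\le n$ and every interleaving: 1. LCC never gets stuck, terminates, and does at most $C\,(wm\log^2 n+w^2n\log^2 n)$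 work; 2. at any time, in particular after step (I) and at the end, there are at most $C\,wn\log n$ labels in total; 3. with the final labels every query $(u,v)$ returns the shortest path distance of $u$ and $v$ and takes at most $C\,w\log n$ steps. Moreover, sequential PLL with the same ranking terminates within the same work bound $C\,(wm\log^2 n+w^2n\log^2 n)$; in this sense LCC is work-efficient relative to sequential PLL. -/

import Mathlib

open scoped NNReal ENNReal

noncomputable section

namespace HubLabeling

/-! ### Weighted distances -/

/-- Length of a walk: the sum of the weights of its edges. -/
def walkLength {V : Type*} {G : SimpleGraph V} (wt : Sym2 V → ℝ≥0) {u v : V}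
    (q : G.Walk u v) : ℝ≥0 :=
  (q.edges.map wt).sum

/-- Shortest path distance; it is `∞` when `u` and `v` are not connected. -/
def weightedDist {V : Type*} (G : SimpleGraph V) (wt : Sym2 V → ℝ≥0) (u v : V) : ℝ≥0∞ :=
  ⨅ q : G.Walk u v, (walkLength wt q : ℝ≥0∞)

/-! ### Tree decompositions, tree-width, centroid decompositions -/

/-- A tree decomposition of `G` whose decomposition tree has node set `ι`. -/
structure TreeDecomposition {V : Type*} (G : SimpleGraph V) (ι : Type*) where
  tree : SimpleGraph ι
  isTree : tree.IsTree
  bag : ι → Finset V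
  exists_mem_bag : ∀ v, ∃ t, v ∈ bag t
  exists_edge_bag : ∀ u v, G.Adj u v → ∃ t, u ∈ bag t ∧ v ∈ bag t
  connected_bags : ∀ v, (tree.induce {t | v ∈ bag t}).Connected

/-- Width: the maximal size of a bag, minus one. -/
def TreeDecomposition.width {V ι : Type*} [Fintype ι] {G : SimpleGraph V}
    (D : TreeDecomposition G ι) : ℕ :=
  (Finset.univ.sup fun t => (D.bag t).card) - 1

/-- Tree-width: the least width of a tree decomposition with finitely many nodes. -/
def treewidth {V : Type*} (G : SimpleGraph V) : ℕ :=
  sInf {k | ∃ (N : ℕ) (D : TreeDecomposition G (Fin N)), D.width = k}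

/-- `C` is (the node set of) a connected component of the subgraph of `T` induced by `S`. -/
def IsComponentOf {ι : Type*} (T : SimpleGraph ι) (S C : Finset ι) : Prop :=
  C ⊆ S ∧ (T.induce (C : Set ι)).Connected ∧ ∀ x ∈ C, ∀ y ∈ S, T.Adj x y → y ∈ C

/-- `IsCentroidDecomposition T depth S d`: on the nodes of the connected part `S` of the tree `T`,
`depth` is the depth function of a centroid decomposition whose root is put at depth `d`.
The root is a centroid `c` of `S`: no component of `S` without `c` has more than half of the
nodes of `S`. The subtrees below it are centroid decompositions of these components. -/
inductive IsCentroidDecomposition {ι : Type*} [DecidableEq ι] (T : SimpleGraph ι)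
    (depth : ι → ℕ) : Finset ι → ℕ → Prop
  | root (S : Finset ι) (d : ℕ) (c : ι) (mem : c ∈ S) (depth_eq : depth c = d)
      (half : ∀ C, IsComponentOf T (S.erase c) C → 2 * C.card ≤ S.card)
      (below : ∀ C, IsComponentOf T (S.erase c) C →
        IsCentroidDecomposition T depth C (d + 1)) :
      IsCentroidDecomposition T depth S d

/-- The least depth of a bag that contains `v`. -/
def TreeDecomposition.minDepth {V ι : Type*} {G : SimpleGraph V} (D : TreeDecomposition G ι)
    (depth : ι → ℕ) (v : V) : ℕ :=
  sInf (depth '' {t | v ∈ D.bag t})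

/-- `R` is a ranking (a larger value is a higher rank, no two vertices have the same rank) that
comes from a centroid decomposition of a minimum-width tree decomposition of `G` with at most
`n ^ K` nodes: vertices whose first bag is closer to the root are ranked higher. -/
def IsCentroidRanking {V : Type*} [Fintype V] (G : SimpleGraph V) (K : ℕ) (R : V → ℕ) : Prop :=
  Function.Injective R ∧
  ∃ (N : ℕ) (D : TreeDecomposition G (Fin N)) (depth : Fin N → ℕ),
    N ≤ Fintype.card V ^ K ∧
    D.width = treewidth G ∧
    IsCentroidDecomposition D.tree depth Finset.univ 0 ∧
    ∀ u v, D.minDepth depth u < D.minDepth depth v → R v < R u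

/-! ### Executions with a work count -/

/-- `Exec step s c t`: some execution (possibly partial) leads from `s` to `t` with work `c`. -/
inductive Exec {σ : Type*} (step : σ → ℕ → σ → Prop) : σ → ℕ → σ → Prop
  | refl (s : σ) : Exec step s 0 s
  | tail {s t u : σ} {c c' : ℕ} (h : Exec step s c t) (h' : step t c' u) :
      Exec step s (c + c') u

/-- Started in `s` after a set-up of work `setup`, no execution ever does more work than `W` in
total, and none gets stuck: it can always be continued to one that ends in a final state. -/
def RunsWithin {σ : Type*} (step : σ → ℕ → σ → Prop) (final : σ → Prop) (setup : ℕ) (s : σ)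
    (W : ℝ) : Prop :=
  ∀ c t, Exec step s c t →
    ((setup + c : ℕ) : ℝ) ≤ W ∧ ∃ c' u, Exec step t c' u ∧ final u

/-! ### Label sets and queries

Work is counted on a random access machine: arithmetic, comparisons, array and hash-table accesses
are unit steps, an operation on a priority queue with `q` entries is charged `1 + ⌊log₂ q⌋`
(binary heap), and sorting `k` entries is charged `k * (1 + ⌊log₂ k⌋)`. -/

/-- A labeling gives each vertex its list of labels `(hub, distance)`. -/
abbrev Labeling (V : Type*) := V → List (V × ℝ≥0)

/-- Number of labels. -/
def labelCount {V : Type*} [Fintype V] (L : Labeling V) : ℕ :=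
  ∑ v, (L v).length

/-- The hash table of a label set. -/
def hashLabels {V : Type*} [DecidableEq V] (l : List (V × ℝ≥0)) (h : V) : Option ℝ≥0 :=
  (l.find? fun a => a.1 = h).map Prod.snd

/-- Distance query with its work: scan the label set of a vertex for a hub that also occurs in the
hash table of the root and gives a total distance of at most `δ`. -/
def distQuery {V : Type*} (table : V → Option ℝ≥0) (δ : ℝ≥0) : List (V × ℝ≥0) → Bool × ℕ
  | [] => (false, 1)
  | (h, d) :: l =>
    match table h with
    | none => ((distQuery table δ l).1, (distQuery table δ l).2 + 1)
    | some d' =>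
      if d + d' ≤ δ then (true, 1)
      else ((distQuery table δ l).1, (distQuery table δ l).2 + 1)

/-- Cleaning query with its work, on two label sets that are sorted by decreasing rank of the hub:
merge them up to the first (thus highest ranked) common hub that gives a total distance of at most
`δ`; the answer is whether there is one and it is ranked higher than `h`. -/
def cleanQuery {V : Type*} [DecidableEq V] (R : V → ℕ) (h : V) (δ : ℝ≥0) :
    List (V × ℝ≥0) → List (V × ℝ≥0) → Bool × ℕ
  | [], _ => (false, 1)
  | _ :: _, [] => (false, 1)
  | (a, da) :: l, (b, db) :: l' =>
    if a = b then
      if da + db ≤ δ then (decide (R h < R a), 1)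
      else ((cleanQuery R h δ l l').1, (cleanQuery R h δ l l').2 + 1)
    else if R b < R a then
      ((cleanQuery R h δ l ((b, db) :: l')).1, (cleanQuery R h δ l ((b, db) :: l')).2 + 1)
    else
      ((cleanQuery R h δ ((a, da) :: l) l').1, (cleanQuery R h δ ((a, da) :: l) l').2 + 1)
termination_by l l' => l.length + l'.length

/-- Point-to-point shortest distance query with its work, on two label sets that are sorted by
decreasing rank of the hub: merge them and return the least total distance via a common hub
(`∞` if there is no common hub). -/
def ppsdQuery {V : Type*} [DecidableEq V] (R : V → ℕ) :
    List (V × ℝ≥0) → List (V × ℝ≥0) → ℝ≥0∞ × ℕ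
  | [], _ => (⊤, 1)
  | _ :: _, [] => (⊤, 1)
  | (a, da) :: l, (b, db) :: l' =>
    if a = b then
      (min ((da + db : ℝ≥0) : ℝ≥0∞) (ppsdQuery R l l').1, (ppsdQuery R l l').2 + 1)
    else if R b < R a then
      ((ppsdQuery R l ((b, db) :: l')).1, (ppsdQuery R l ((b, db) :: l')).2 + 1)
    else
      ((ppsdQuery R ((a, da) :: l) l').1, (ppsdQuery R ((a, da) :: l) l').2 + 1)
termination_by l l' => l.length + l'.length

/-! ### Label construction: concurrent pruned Dijkstra searches -/

/-- What the threads share: the roots that are still to be processed, and the labels. -/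
structure Memory (V : Type*) where
  queue : List V
  labels : Labeling V

/-- The local data of a pruned Dijkstra search: its root, the hash table of the label set of the
root, the tentative distances, and the vertices in the priority queue (keyed by `dist`). -/
structure Search (V : Type*) where
  root : V
  table : V → Option ℝ≥0
  dist : V → ℝ≥0∞
  heap : Finset V

/-- Control states of a thread. -/
inductive Thread (V : Type*)
  | idle
  | halted
  | starting (h : V)
  | looping (r : Search V)
  | popped (r : Search V) (v : V) (d : ℝ≥0)
  | querying (r : Search V) (v : V) (d : ℝ≥0)
  | inserting (r : Search V) (v : V) (d : ℝ≥0)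
  | relaxing (r : Search V) (v : V) (d : ℝ≥0) (rest : List V)

/-- One atomic step of a thread, with its work. With `rankQueries = true` this is pruned Dijkstra
with rank queries; with `rankQueries = false` searches are pruned by distance queries only. -/
inductive ThreadStep {V : Type*} [Fintype V] [DecidableEq V] (G : SimpleGraph V)
    [DecidableRel G.Adj] (wt : Sym2 V → ℝ≥0) (R : V → ℕ) (rankQueries : Bool) :
    Memory V → Thread V → ℕ → Memory V → Thread V → Prop
  /-- No root is left. -/
  | halt (L : Labeling V) :
      ThreadStep G wt R rankQueries ⟨[], L⟩ .idle 1 ⟨[], L⟩ .halted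
  /-- Atomically pop the highest ranked root. -/
  | take (h : V) (q : List V) (L : Labeling V) :
      ThreadStep G wt R rankQueries ⟨h :: q, L⟩ .idle 1 ⟨q, L⟩ (.starting h)
  /-- Hash the label set of the root and put the root into the priority queue. -/
  | start (M : Memory V) (h : V) :
      ThreadStep G wt R rankQueries M (.starting h) (2 + (M.labels h).length) M
        (.looping ⟨h, hashLabels (M.labels h), Function.update (fun _ => ⊤) h 0, {h}⟩)
  /-- The priority queue is empty: reset the entries of the tables that are in use. -/
  | finish (M : Memory V) (r : Search V) (empty : r.heap = ∅) :
      ThreadStep G wt R rankQueries M (.looping r)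
        (1 + {v | r.dist v ≠ ⊤}.ncard + {v | r.table v ≠ none}.ncard) M .idle
  /-- Pop a vertex of least tentative distance (ties are broken arbitrarily). -/
  | pop (M : Memory V) (r : Search V) (v : V) (d : ℝ≥0) (mem : v ∈ r.heap)
      (dist_eq : r.dist v = d) (least : ∀ u ∈ r.heap, r.dist v ≤ r.dist u) :
      ThreadStep G wt R rankQueries M (.looping r) (1 + (1 + Nat.log 2 r.heap.card)) M
        (.popped { r with heap := r.heap.erase v } v d)
  /-- Rank query: prune at a vertex that is ranked higher than the root. -/
  | rankPrune (M : Memory V) (r : Search V) (v : V) (d : ℝ≥0)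
      (prune : rankQueries = true ∧ R r.root < R v) :
      ThreadStep G wt R rankQueries M (.popped r v d) 1 M (.looping r)
  | rankPass (M : Memory V) (r : Search V) (v : V) (d : ℝ≥0)
      (pass : ¬ (rankQueries = true ∧ R r.root < R v)) :
      ThreadStep G wt R rankQueries M (.popped r v d) 1 M (.querying r v d)
  /-- Distance query: prune if it returns `true`. -/
  | query (M : Memory V) (r : Search V) (v : V) (d : ℝ≥0) :
      ThreadStep G wt R rankQueries M (.querying r v d) (distQuery r.table d (M.labels v)).2 M
        (if (distQuery r.table d (M.labels v)).1 then .looping r else .inserting r v d)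
  /-- Append the root as a hub to the label set of the vertex. -/
  | insert (M : Memory V) (r : Search V) (v : V) (d : ℝ≥0) :
      ThreadStep G wt R rankQueries M (.inserting r v d) 1
        { M with labels := Function.update M.labels v (M.labels v ++ [(r.root, d)]) }
        (.relaxing r v d (G.neighborFinset v).toList)
  /-- Relax the edge to the next neighbor, with a shorter tentative distance. -/
  | relax (M : Memory V) (r : Search V) (v : V) (d : ℝ≥0) (u : V) (rest : List V)
      (shorter : ((d + wt s(v, u) : ℝ≥0) : ℝ≥0∞) < r.dist u) :
      ThreadStep G wt R rankQueries M (.relaxing r v d (u :: rest))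
        (1 + (1 + Nat.log 2 (insert u r.heap).card)) M
        (.relaxing
          { r with
            dist := Function.update r.dist u ((d + wt s(v, u) : ℝ≥0) : ℝ≥0∞)
            heap := insert u r.heap }
          v d rest)
  /-- Relax the edge to the next neighbor, without an improvement. -/
  | skip (M : Memory V) (r : Search V) (v : V) (d : ℝ≥0) (u : V) (rest : List V)
      (longer : r.dist u ≤ ((d + wt s(v, u) : ℝ≥0) : ℝ≥0∞)) :
      ThreadStep G wt R rankQueries M (.relaxing r v d (u :: rest)) 1 M (.relaxing r v d rest)
  /-- All neighbors have been treated. -/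
  | relaxed (M : Memory V) (r : Search V) (v : V) (d : ℝ≥0) :
      ThreadStep G wt R rankQueries M (.relaxing r v d []) 1 M (.looping r)

/-- State of the label construction with `p` threads. -/
structure BuildState (V : Type*) (p : ℕ) where
  memory : Memory V
  thread : Fin p → Thread V

/-- One step of the label construction: any of the threads makes a step. -/
inductive BuildStep {V : Type*} [Fintype V] [DecidableEq V] (G : SimpleGraph V)
    [DecidableRel G.Adj] (wt : Sym2 V → ℝ≥0) (R : V → ℕ) (rankQueries : Bool) {p : ℕ} :
    BuildState V p → ℕ → BuildState V p → Prop
  | mk (s : BuildState V p) (i : Fin p) (c : ℕ) (M : Memory V) (t : Thread V)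
      (h : ThreadStep G wt R rankQueries s.memory (s.thread i) c M t) :
      BuildStep G wt R rankQueries s c ⟨M, Function.update s.thread i t⟩

/-- The vertices in the order of decreasing rank. -/
def rankOrder {V : Type*} [Fintype V] (R : V → ℕ) : List V :=
  (Finset.univ : Finset V).toList.mergeSort fun a b => decide (R b ≤ R a)

/-- At the start there are no labels and all vertices wait in the order of their rank. -/
def BuildState.start {V : Type*} [Fintype V] (R : V → ℕ) (p : ℕ) : BuildState V p :=
  ⟨⟨rankOrder R, fun _ => []⟩, fun _ => .idle⟩

def BuildState.Final {V : Type*} {p : ℕ} (s : BuildState V p) : Prop :=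
  ∀ i, s.thread i = .halted

/-- Work of the set-up: empty the `n` label sets and sort the `n` vertices by rank. -/
def setupWork (V : Type*) [Fintype V] : ℕ :=
  Fintype.card V + Fintype.card V * (1 + Nat.log 2 (Fintype.card V))

/-- Sequential pruned landmark labeling finishes within work `W`: a single thread runs the
searches in rank order and prunes them by distance queries only. -/
def PLLRunsWithin {V : Type*} [Fintype V] [DecidableEq V] (G : SimpleGraph V)
    [DecidableRel G.Adj] (wt : Sym2 V → ℝ≥0) (R : V → ℕ) (W : ℝ) : Prop :=
  RunsWithin (BuildStep G wt R false) BuildState.Final (setupWork V) (BuildState.start R 1) W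

/-! ### Label cleaning -/

/-- Control states of the cleaning loop of one vertex: `scan l` when the labels in `l` are still to
be checked, `erase h l` when the label with hub `h` has been found redundant. -/
inductive Cleaner (V : Type*)
  | scan (l : List (V × ℝ≥0))
  | erase (h : V) (l : List (V × ℝ≥0))

structure CleanState (V : Type*) where
  labels : Labeling V
  cleaner : V → Cleaner V

/-- One step of the label cleaning: the cleaning loop of any vertex `v` makes a step. -/
inductive CleanStep {V : Type*} [DecidableEq V] (R : V → ℕ) :
    CleanState V → ℕ → CleanState V → Prop
  | check (s : CleanState V) (v h : V) (δ : ℝ≥0) (l : List (V × ℝ≥0))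
      (at_v : s.cleaner v = .scan ((h, δ) :: l)) :
      CleanStep R s (1 + (cleanQuery R h δ (s.labels h) (s.labels v)).2)
        { s with
          cleaner := Function.update s.cleaner v
            (if (cleanQuery R h δ (s.labels h) (s.labels v)).1 then .erase h l else .scan l) }
  | erase (s : CleanState V) (v h : V) (l : List (V × ℝ≥0))
      (at_v : s.cleaner v = .erase h l) :
      CleanStep R s (1 + (s.labels v).length)
        ⟨Function.update s.labels v ((s.labels v).filter fun a => a.1 ≠ h),
          Function.update s.cleaner v (.scan l)⟩

/-- Sort every label set by decreasing rank of the hub. -/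
def sortLabels {V : Type*} (R : V → ℕ) (L : Labeling V) : Labeling V :=
  fun v => (L v).mergeSort fun a b => decide (R b.1 ≤ R a.1)

/-- Work of sorting the label sets and of starting the cleaning loop of each vertex. -/
def sortWork {V : Type*} [Fintype V] (L : Labeling V) : ℕ :=
  ∑ v, (2 + (L v).length * (1 + Nat.log 2 (L v).length))

/-- The cleaning starts with sorted label sets, and will check every label. -/
def CleanState.start {V : Type*} (R : V → ℕ) (L : Labeling V) : CleanState V :=
  ⟨sortLabels R L, fun v => .scan (sortLabels R L v)⟩

def CleanState.Final {V : Type*} (s : CleanState V) : Prop :=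
  ∀ v, s.cleaner v = .scan []

/-! ### LCC: label construction and cleaning -/

inductive LCCState (V : Type*) (p : ℕ)
  | constructing (s : BuildState V p)
  | cleaning (s : CleanState V)

/-- The labels that are stored in a state. -/
def LCCState.labels {V : Type*} {p : ℕ} : LCCState V p → Labeling V
  | .constructing s => s.memory.labels
  | .cleaning s => s.labels

def LCCState.Final {V : Type*} {p : ℕ} : LCCState V p → Prop
  | .constructing _ => False
  | .cleaning s => s.Final

def LCCState.start {V : Type*} [Fintype V] (R : V → ℕ) (p : ℕ) : LCCState V p :=
  .constructing (BuildState.start R p)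

/-- One step of LCC: a step of the label construction, which uses rank queries; sorting, when all
threads have halted; or a step of the label cleaning. -/
inductive LCCStep {V : Type*} [Fintype V] [DecidableEq V] (G : SimpleGraph V)
    [DecidableRel G.Adj] (wt : Sym2 V → ℝ≥0) (R : V → ℕ) {p : ℕ} :
    LCCState V p → ℕ → LCCState V p → Prop
  | build (s s' : BuildState V p) (c : ℕ) (h : BuildStep G wt R true s c s') :
      LCCStep G wt R (.constructing s) c (.constructing s')
  | sort (s : BuildState V p) (h : s.Final) :
      LCCStep G wt R (.constructing s) (sortWork s.memory.labels)
        (.cleaning (CleanState.start R s.memory.labels))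
  | clean (s s' : CleanState V) (c : ℕ) (h : CleanStep R s c s') :
      LCCStep G wt R (.cleaning s) c (.cleaning s')

/-- LCC with `p` threads finishes within work `W`, whatever the interleaving of the threads. -/
def LCCRunsWithin {V : Type*} [Fintype V] [DecidableEq V] (G : SimpleGraph V)
    [DecidableRel G.Adj] (wt : Sym2 V → ℝ≥0) (R : V → ℕ) (p : ℕ) (W : ℝ) : Prop :=
  RunsWithin (LCCStep G wt R) LCCState.Final (setupWork V) (LCCState.start R p) W

/-- `s` is a state that LCC with `p` threads can reach. -/
def LCCReaches {V : Type*} [Fintype V] [DecidableEq V] (G : SimpleGraph V)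
    [DecidableRel G.Adj] (wt : Sym2 V → ℝ≥0) (R : V → ℕ) (p : ℕ) (s : LCCState V p) : Prop :=
  ∃ c, Exec (LCCStep G wt R) (LCCState.start R p) c s

/-- The bound `w m log² n + w² n log² n`, with `w` the tree-width. -/
def workBound {V : Type*} [Fintype V] [DecidableEq V] (G : SimpleGraph V)
    [DecidableRel G.Adj] : ℝ :=
  (treewidth G : ℝ) * (G.edgeFinset.card : ℝ) * Real.log (Fintype.card V) ^ 2 +
    (treewidth G : ℝ) ^ 2 * (Fintype.card V : ℝ) * Real.log (Fintype.card V) ^ 2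

end HubLabeling

end

/-!
LCC and sequential PLL meet the tree-width bounds because of three facts.

*Few potential hubs.* With rank queries, a search from `h` labels only vertices that are joined to
`h` by a walk of vertices ranked at most as high as `h` (`LowReach`). Let `v` be such a vertex and
descend the centroid decomposition for as long as all bags of `h` and of `v` lie in the same part
`S`. A walk whose vertices are not ranked higher than `h` avoids the bags above `S`, and it can be
separated at the root `c` of `S` only by the bag of `c`; so the descent ends when `h` is in that
bag. Parts at least halve in size, so `h` is in the union `A v` of `O(log n)` bags, and `v` has at most
`B = O(w log n)` hubs. If `v` is only adjacent to a labelled vertex, the descent may also end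
because `v` is in the bag, and then `v ∈ A h`. This symmetric version
(`IsCentroidDecomposition.exists_hubSets`) is what bounds the distance queries of sequential PLL,
where vertices that are ranked higher than the root are popped and pruned by a distance query: in
total `O(n B)` pairs of a root and a vertex are ever popped, at a cost of `O(B)` each, and `O(m B)`
edges are relaxed, at a cost of `O(log n)` each.

*Canonical hubs.* Call `h` a canonical hub of `v` if it has the highest rank among all vertices on
shortest paths between them. Then `h` is canonical for every vertex on these paths, and neither kind
of query can prune the search from `h` there: hubs of `h` other than `h` itself are ranked higher
than `h`, so a successful query would exhibit a higher ranked vertex on a shortest path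
(`SearchInv.not_canonical_of_distQuery`). Therefore Dijkstra's argument works along these paths
(`SearchInv.done_or_exists_heap_le`), whatever the other threads do. For the same reason the
cleaning never deletes a canonical label. The highest ranked vertex on the shortest paths between
`u` and `v` is a canonical hub of both, so queries are exact. In sequential PLL the canonical labels
of all higher ranked roots are there when a search starts, and they make the distance query succeed
at every vertex that is ranked higher than the root (`SearchInv.distQuery_eq_true`); hence the
searches expand the same kind of vertices as with rank queries.

*A potential.* The work that is still to be done is bounded by a function of the current state
(`HubSets.buildCost`, `cleanCost`) that pays for every single step of every thread. This bounds the
work for all interleavings at once, and since each step has positive work and only final states have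
no successor, every execution can be completed (`runsWithin_of_potential`).

A centroid ranking with at most `n` nodes exists because in a tree decomposition of minimum width
with the least number of nodes no bag is contained in an adjacent one: otherwise the edge between
them could be contracted. Hence every node adds a new vertex when the tree is swept from some node.
-/

noncomputable section

namespace HubLabeling

/-! ### Connected sets of nodes of a tree -/

section Trees

variable {ι : Type*} {T : SimpleGraph ι}

/-- A property that is inherited along the edges inside a connected set holds on the whole set as
soon as it holds at one node. -/
theorem forall_mem_of_connected {C : Set ι} (hC : (T.induce C).Connected) {P : ι → Prop} {x : ι}
    (hx : x ∈ C) (hPx : P x) (hstep : ∀ a ∈ C, ∀ b ∈ C, T.Adj a b → P a → P b) :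
    ∀ y ∈ C, P y := by
  intro y hy
  obtain ⟨q⟩ := hC.preconnected ⟨x, hx⟩ ⟨y, hy⟩
  have key : ∀ (a b : C), (T.induce C).Walk a b → P a → P b := by
    intro a b q
    induction q with
    | nil => exact id
    | cons hadj _ ih =>
      intro ha
      exact ih (hstep _ (Subtype.property _) _ (Subtype.property _) hadj ha)
  exact key _ _ q hPx

/-- Inside a connected set any two nodes are joined by a path that stays in the set. -/
theorem exists_path_of_connected {C : Set ι} (hC : (T.induce C).Connected) {x y : ι}
    (hx : x ∈ C) (hy : y ∈ C) : ∃ q : T.Walk x y, q.IsPath ∧ ∀ z ∈ q.support, z ∈ C := by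
  obtain ⟨q, hq⟩ := (hC.preconnected ⟨x, hx⟩ ⟨y, hy⟩).exists_isPath
  let f : T.induce C →g T := (SimpleGraph.Embedding.induce C).toHom
  refine ⟨q.map f, hq.map Subtype.val_injective, ?_⟩
  intro z hz
  obtain ⟨a, -, rfl⟩ :=
    List.mem_map.1 ((congrArg (z ∈ ·) (SimpleGraph.Walk.support_map f q)).mp hz)
  exact a.2

/-- In a forest there is at most one edge between two disjoint connected sets: two edges would
close a cycle. -/
theorem eq_of_adj_of_disjoint_connected (hT : T.IsAcyclic) {A B : Set ι}
    (hA : (T.induce A).Connected) (hB : (T.induce B).Connected) (hAB : Disjoint A B)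
    {a a' b b' : ι} (ha : a ∈ A) (ha' : a' ∈ A) (hb : b ∈ B) (hb' : b' ∈ B)
    (hab : T.Adj a b) (hab' : T.Adj a' b') : a = a' := by
  obtain ⟨p, hp, hpA⟩ := exists_path_of_connected hA ha ha'
  obtain ⟨q, hq, hqB⟩ := exists_path_of_connected hB hb hb'
  have h1 : (p.concat hab').IsPath :=
    hp.concat (fun h => Set.disjoint_left.1 hAB (hpA _ h) hb') hab'
  have h2 : (SimpleGraph.Walk.cons hab q).IsPath :=
    hq.cons (fun h => Set.disjoint_left.1 hAB ha (hqB _ h))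
  have h3 : p.concat hab' = SimpleGraph.Walk.cons hab q :=
    congrArg Subtype.val ((hT.subsingleton_path a b').elim ⟨_, h1⟩ ⟨_, h2⟩)
  cases p with
  | nil => rfl
  | cons h p =>
    exfalso
    have h4 := congrArg SimpleGraph.Walk.support h3
    rw [SimpleGraph.Walk.concat_cons, SimpleGraph.Walk.support_cons,
      SimpleGraph.Walk.support_cons, ← SimpleGraph.Walk.cons_tail_support,
      ← SimpleGraph.Walk.cons_tail_support q] at h4
    simp only [List.cons.injEq, true_and] at h4
    refine Set.disjoint_left.1 hAB (hpA _ ?_) (h4.1 ▸ hb)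
    simp

theorem connected_singleton (x : ι) : (T.induce ({x} : Set ι)).Connected :=
  SimpleGraph.Connected.mk fun a b => Subsingleton.elim a b ▸ SimpleGraph.Reachable.refl _

theorem connected_insert [DecidableEq ι] {C : Finset ι} (hC : (T.induce (C : Set ι)).Connected)
    {a y : ι} (ha : a ∈ C) (hay : T.Adj a y) :
    (T.induce ((insert y C : Finset ι) : Set ι)).Connected := by
  have h1 := SimpleGraph.induce_union_connected (G := T) hC.preconnected
    (SimpleGraph.induce_pair_connected_of_adj hay).preconnected ⟨a, ha, by simp⟩
  have h2 : ((insert y C : Finset ι) : Set ι) = (C : Set ι) ∪ {a, y} := by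
    ext z
    simp only [Finset.coe_insert, Set.mem_insert_iff, Finset.mem_coe, Set.mem_union,
      Set.mem_singleton_iff]
    constructor
    · rintro (h | h) <;> simp [h]
    · rintro (h | h | h)
      · exact Or.inr h
      · exact Or.inr (h ▸ ha)
      · exact Or.inl h
  rw [h2]
  exact h1

/-! ### Components and centroids -/

theorem IsComponentOf.nonempty {S C : Finset ι} (h : IsComponentOf T S C) : C.Nonempty := by
  obtain ⟨x⟩ := h.2.1.nonempty
  exact ⟨x, x.2⟩

theorem IsComponentOf.subset_of_connected {S C : Finset ι} (h : IsComponentOf T S C) {A : Set ι}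
    (hA : (T.induce A).Connected) (hAS : ∀ y ∈ A, y ∈ S) {x : ι} (hxC : x ∈ C) (hxA : x ∈ A) :
    ∀ y ∈ A, y ∈ C :=
  forall_mem_of_connected hA (P := fun y => y ∈ C) hxA hxC
    fun a _ b hb hab ha => h.2.2 a ha b (hAS b hb) hab

theorem IsComponentOf.eq_of_mem {S C C' : Finset ι} (h : IsComponentOf T S C)
    (h' : IsComponentOf T S C') {x : ι} (hx : x ∈ C) (hx' : x ∈ C') : C = C' :=
  Finset.Subset.antisymm
    (fun y hy => h'.subset_of_connected h.2.1 (fun _ hz => h.1 hz) hx' hx y hy)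
    (fun y hy => h.subset_of_connected h'.2.1 (fun _ hz => h'.1 hz) hx hx' y hy)

theorem exists_isComponentOf {S : Finset ι} {x : ι} (hx : x ∈ S) :
    ∃ C, IsComponentOf T S C ∧ x ∈ C := by
  classical
  let P : Finset ι → Prop := fun C => x ∈ C ∧ C ⊆ S ∧ (T.induce (C : Set ι)).Connected
  have hP : ∃ C ∈ S.powerset, P C := by
    refine ⟨{x}, by simpa using hx, by simp, by simpa using hx, ?_⟩
    rw [Finset.coe_singleton]
    exact connected_singleton x
  obtain ⟨C, hC⟩ := (S.powerset.filter P).exists_maximal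
    (by obtain ⟨C, h1, h2⟩ := hP; exact ⟨C, Finset.mem_filter.2 ⟨h1, h2⟩⟩)
  have hCP := (Finset.mem_filter.1 hC.1).2
  refine ⟨C, ⟨hCP.2.1, hCP.2.2, ?_⟩, hCP.1⟩
  intro a ha y hy hay
  have hmem : insert y C ∈ S.powerset.filter P :=
    Finset.mem_filter.2 ⟨Finset.mem_powerset.2 (Finset.insert_subset hy hCP.2.1),
      Finset.mem_insert_of_mem hCP.1, Finset.insert_subset hy hCP.2.1,
      connected_insert hCP.2.2 ha hay⟩
  exact hC.2 hmem (Finset.subset_insert y C) (Finset.mem_insert_self y C)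

variable [DecidableEq ι]

/-- Every connected set of nodes of a forest has a centroid: from a node with a component of more
than half of the nodes, moving to the neighbor in that component decreases the component. -/
theorem exists_centroid (hT : T.IsAcyclic) {S : Finset ι}
    (hS : (T.induce (S : Set ι)).Connected) :
    ∃ c ∈ S, ∀ C, IsComponentOf T (S.erase c) C → 2 * C.card ≤ S.card := by
  by_contra hcon
  push Not at hcon
  -- induction on the size `k` of a component `C` with more than half of the nodes
  have key : ∀ k : ℕ, ∀ c ∈ S, ∀ C, IsComponentOf T (S.erase c) C → S.card < 2 * C.card →
      C.card = k → False := by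
    intro k
    induction k using Nat.strong_induction_on with
    | _ k ih =>
    intro c hc C hC hbig hk
    have hcC : c ∉ C := fun h => Finset.notMem_erase c S (hC.1 h)
    obtain ⟨x, hx⟩ := hC.nonempty
    have hCS : C ⊆ S := hC.1.trans (Finset.erase_subset c S)
    obtain ⟨c', hc', hadj⟩ : ∃ c' ∈ C, T.Adj c' c := by
      by_contra hno
      push Not at hno
      refine hcC (forall_mem_of_connected hS (P := fun y => y ∈ C) (hCS hx) hx ?_ c hc)
      intro a _ b hb hab ha
      refine hC.2.2 a ha b (Finset.mem_erase.2 ⟨?_, hb⟩) hab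
      rintro rfl
      exact hno a ha hab
    obtain ⟨C', hC', hbig'⟩ := hcon c' (hCS hc')
    have hc'C' : c' ∉ C' := fun h => Finset.notMem_erase c' S (hC'.1 h)
    have hC'S : C' ⊆ S := hC'.1.trans (Finset.erase_subset c' S)
    -- `C'` cannot be disjoint from `C`, as both have more than half of the nodes, so it is smaller
    by_cases hdisj : Disjoint C C'
    · have h1 := Finset.card_union_of_disjoint hdisj
      have h2 := Finset.card_le_card (Finset.union_subset hCS hC'S)
      omega
    · obtain ⟨y, hyC, hyC'⟩ := Finset.not_disjoint_iff.1 hdisj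
      have hsub : ∀ z ∈ (C' : Set ι), z ∈ C := by
        refine forall_mem_of_connected hC'.2.1 (P := fun z => z ∈ C) hyC' hyC ?_
        intro a ha b hb hab haC
        refine hC.2.2 a haC b (Finset.mem_erase.2 ⟨?_, hC'S hb⟩) hab
        rintro rfl
        -- the edges `a b` and `c' b` would be two edges between `C` and the node `b`
        have : a = c' := eq_of_adj_of_disjoint_connected hT hC.2.1 (connected_singleton b)
          (Set.disjoint_left.2 fun z hz hzb => hcC (by
            have : z = b := hzb
            exact this ▸ hz)) haC hc' rfl rfl hab hadj
        exact hc'C' (this ▸ ha)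
      have hlt : C'.card < C.card :=
        Finset.card_lt_card ⟨hsub, fun h => hc'C' (h hc')⟩
      exact ih _ (hk ▸ hlt) c' (hCS hc') C' hC' hbig' rfl
  obtain ⟨x⟩ := hS.nonempty
  obtain ⟨C, hC, hbig⟩ := hcon x x.2
  exact key _ x x.2 C hC hbig rfl

/-- Whether `depth` describes a centroid decomposition of `S` depends on its values on `S` only. -/
theorem IsCentroidDecomposition.congr {depth depth' : ι → ℕ} {S : Finset ι} {d : ℕ}
    (h : IsCentroidDecomposition T depth S d) (heq : ∀ x ∈ S, depth x = depth' x) :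
    IsCentroidDecomposition T depth' S d := by
  induction h with
  | root S d c mem depth_eq half below ih =>
    refine .root S d c mem ((heq c mem).symm.trans depth_eq) half fun C hC => ih C hC ?_
    exact fun x hx => heq x (Finset.mem_of_mem_erase (hC.1 hx))

theorem exists_isCentroidDecomposition (hT : T.IsAcyclic) (S : Finset ι)
    (hS : (T.induce (S : Set ι)).Connected) (d : ℕ) :
    ∃ depth, IsCentroidDecomposition T depth S d := by
  induction hk : S.card using Nat.strong_induction_on generalizing S d with
  | _ k ih =>
  obtain ⟨c, hc, hhalf⟩ := exists_centroid hT hS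
  have hex : ∀ C, IsComponentOf T (S.erase c) C →
      ∃ depth, IsCentroidDecomposition T depth C (d + 1) := fun C hC =>
    ih C.card (hk ▸ Finset.card_lt_card
      (lt_of_le_of_lt hC.1 (Finset.erase_ssubset hc))) C hC.2.1 (d + 1) rfl
  choose! f hf using hex
  classical
  -- every component keeps the depths of its own decomposition
  let depth : ι → ℕ := fun x =>
    if x = c then d else
      if h : ∃ C, IsComponentOf T (S.erase c) C ∧ x ∈ C then f h.choose x else 0
  refine ⟨depth, .root S d c hc (by simp [depth]) hhalf fun C hC => (hf C hC).congr ?_⟩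
  intro x hx
  have hxc : x ≠ c := fun h => Finset.notMem_erase c S (h ▸ hC.1 hx)
  have h : ∃ C, IsComponentOf T (S.erase c) C ∧ x ∈ C := ⟨C, hC, hx⟩
  have hch : h.choose = C := h.choose_spec.1.eq_of_mem hC h.choose_spec.2 hx
  simp only [depth, if_neg hxc, dif_pos h, hch]

end Trees

/-! ### Small tree decompositions and the existence of centroid rankings -/

section Contraction

variable {ι κ V : Type*} {T : SimpleGraph ι}

theorem exists_crossing_edge {C : Set ι} (hC : (T.induce C).Connected) {P : ι → Prop} {x y : ι}
    (hx : x ∈ C) (hPx : P x) (hy : y ∈ C) (hPy : ¬ P y) :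
    ∃ a ∈ C, ∃ b ∈ C, T.Adj a b ∧ P a ∧ ¬ P b := by
  by_contra hno
  push Not at hno
  exact hPy (forall_mem_of_connected hC hx hPx (fun a ha b hb hab h => hno a ha b hb hab h) y hy)

theorem connected_induce_univ (hT : T.Connected) : (T.induce (Set.univ : Set ι)).Connected :=
  (SimpleGraph.induceUnivIso T).connected_iff.2 hT

/-- A map that sends adjacent nodes to equal or adjacent nodes preserves connected sets. -/
theorem connected_image {T' : SimpleGraph κ} {φ : ι → κ}
    (hφ : ∀ x y, T.Adj x y → φ x = φ y ∨ T'.Adj (φ x) (φ y)) {C : Set ι}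
    (hC : (T.induce C).Connected) : (T'.induce (φ '' C)).Connected := by
  obtain ⟨x₀⟩ := hC.nonempty
  have key : ∀ y (hy : y ∈ C), (T'.induce (φ '' C)).Reachable
      ⟨φ x₀, Set.mem_image_of_mem φ x₀.2⟩ ⟨φ y, Set.mem_image_of_mem φ hy⟩ := by
    intro y hy
    refine forall_mem_of_connected hC (P := fun y => ∀ hy : y ∈ C,
      (T'.induce (φ '' C)).Reachable ⟨φ x₀, Set.mem_image_of_mem φ x₀.2⟩
        ⟨φ y, Set.mem_image_of_mem φ hy⟩) x₀.2 (fun _ => .refl _) ?_ y hy hy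
    intro a ha b hb hab h hb'
    refine (h ha).trans ?_
    rcases hφ a b hab with he | he
    · exact (Subtype.ext he : (⟨φ a, Set.mem_image_of_mem φ ha⟩ : φ '' C) =
        ⟨φ b, Set.mem_image_of_mem φ hb⟩) ▸ .refl _
    · exact SimpleGraph.Adj.reachable (G := T'.induce (φ '' C)) he
  have : Nonempty (φ '' C) := ⟨⟨φ x₀, Set.mem_image_of_mem φ x₀.2⟩⟩
  refine SimpleGraph.Connected.mk ?_
  rintro ⟨_, a, ha, rfl⟩ ⟨_, b, hb, rfl⟩
  exact (key a ha).symm.trans (key b hb)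

/-- Contracting an edge of the decomposition tree. The map `φ` identifies the ends of the edge, and
the bag of a contracted node is the bag of its representative under `g`. -/
theorem TreeDecomposition.exists_contraction [Fintype ι] [Fintype κ] {G : SimpleGraph V}
    (D : TreeDecomposition G ι) (φ : ι → κ) (g : κ → ι) (hg : ∀ a, φ (g a) = a)
    (hcard : Fintype.card κ + 1 = Fintype.card ι) {s t : ι} (hst : D.tree.Adj s t)
    (hφ : φ s = φ t) (hbag : ∀ x, D.bag x ⊆ D.bag (g (φ x))) :
    ∃ D' : TreeDecomposition G κ, ∀ a, D'.bag a = D.bag (g a) := by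
  classical
  let T' : SimpleGraph κ :=
    { Adj := fun a b => a ≠ b ∧ ∃ x y, φ x = a ∧ φ y = b ∧ D.tree.Adj x y
      symm := ⟨fun a b ⟨hne, x, y, hx, hy, hxy⟩ => ⟨hne.symm, y, x, hy, hx, hxy.symm⟩⟩
      loopless := ⟨fun a h => h.1 rfl⟩ }
  have hadj : ∀ x y, D.tree.Adj x y → φ x = φ y ∨ T'.Adj (φ x) (φ y) := by
    intro x y hxy
    by_cases h : φ x = φ y
    · exact Or.inl h
    · exact Or.inr ⟨h, x, y, rfl, rfl, hxy⟩
  have hconn : T'.Connected := by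
    have h := connected_image hadj (connected_induce_univ D.isTree.connected)
    rw [Set.image_univ_of_surjective (fun a => ⟨g a, hg a⟩)] at h
    exact (SimpleGraph.induceUnivIso T').connected_iff.1 h
  -- the contracted edge is lost, so the number of edges drops with the number of nodes
  have hedges : T'.edgeFinset ⊆ (D.tree.edgeFinset.erase s(s, t)).image (Sym2.map φ) := by
    intro e
    induction e using Sym2.ind with
    | _ a b =>
    intro he
    rw [SimpleGraph.mem_edgeFinset, SimpleGraph.mem_edgeSet] at he
    obtain ⟨hne, x, y, rfl, rfl, hxy⟩ := he
    refine Finset.mem_image.2 ⟨s(x, y), Finset.mem_erase.2 ⟨?_, ?_⟩, rfl⟩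
    · intro h
      rcases Sym2.eq_iff.1 h with ⟨rfl, rfl⟩ | ⟨rfl, rfl⟩
      · exact hne hφ
      · exact hne hφ.symm
    · simpa using hxy
  have htree : T'.IsTree := by
    rw [SimpleGraph.isTree_iff_connected_and_card]
    refine ⟨hconn, ?_⟩
    have h1 := hconn.card_vert_le_card_edgeSet_add_one
    have h2 := D.isTree.card_edgeFinset
    have h3 := (Finset.card_le_card hedges).trans Finset.card_image_le
    rw [Finset.card_erase_of_mem (by simpa using hst)] at h3
    have h5 : Nat.card T'.edgeSet = T'.edgeFinset.card := by
      rw [Nat.card_eq_fintype_card, ← SimpleGraph.edgeFinset_card]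
    rw [h5, Nat.card_eq_fintype_card] at h1 ⊢
    have h4 : 0 < D.tree.edgeFinset.card :=
      Finset.card_pos.2 ⟨s(s, t), by simpa using hst⟩
    omega
  refine ⟨⟨T', htree, fun a => D.bag (g a), ?_, ?_, ?_⟩, fun a => rfl⟩
  · intro v
    obtain ⟨x, hx⟩ := D.exists_mem_bag v
    exact ⟨φ x, hbag x hx⟩
  · intro u v huv
    obtain ⟨x, hx, hx'⟩ := D.exists_edge_bag u v huv
    exact ⟨φ x, hbag x hx, hbag x hx'⟩
  · intro v
    have h := connected_image hadj (D.connected_bags v)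
    have he : φ '' {x | v ∈ D.bag x} = {a | v ∈ D.bag (g a)} := by
      ext a
      constructor
      · rintro ⟨x, hx, rfl⟩
        exact hbag x hx
      · intro ha
        exact ⟨g a, ha, hg a⟩
    rwa [he] at h

theorem TreeDecomposition.exists_contraction_fin {N : ℕ} {G : SimpleGraph V}
    (D : TreeDecomposition G (Fin N)) {s t : Fin N} (hst : D.tree.Adj s t)
    (hsub : D.bag s ⊆ D.bag t) :
    ∃ M, M < N ∧ ∃ D' : TreeDecomposition G (Fin M), D'.width ≤ D.width := by
  classical
  have hcard : Fintype.card {x : Fin N // x ≠ s} = N - 1 := by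
    simp [Fintype.card_subtype_compl]
  have hN : 0 < N := Fin.pos s
  let e : {x : Fin N // x ≠ s} ≃ Fin (N - 1) := Fintype.equivFinOfCardEq hcard
  let φ : Fin N → Fin (N - 1) := fun x =>
    e (if h : x = s then ⟨t, hst.ne'⟩ else ⟨x, h⟩)
  obtain ⟨D', hD'⟩ := D.exists_contraction φ (fun a => (e.symm a).1)
    (fun a => by simp [φ, (e.symm a).2]) (by simp; omega) hst
    (by simp [φ, hst.ne']) (by
      intro x
      by_cases h : x = s
      · subst h
        simpa [φ] using hsub
      · simp [φ, h])
  refine ⟨N - 1, by omega, D', ?_⟩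
  refine Nat.sub_le_sub_right (Finset.sup_le fun a _ => ?_) 1
  rw [hD']
  exact Finset.le_sup (f := fun t => (D.bag t).card) (Finset.mem_univ _)

/-- If no bag is contained in an adjacent bag, every node adds a new vertex when the tree is
swept from some node, so that there are at most as many nodes as vertices. -/
theorem TreeDecomposition.card_le_of_not_subset [Fintype ι] [Fintype V] [Nonempty V]
    {G : SimpleGraph V} (D : TreeDecomposition G ι)
    (h : ∀ s t, D.tree.Adj s t → ¬ D.bag s ⊆ D.bag t) : Fintype.card ι ≤ Fintype.card V := by
  classical
  -- the nodes that have been swept: a maximal connected set with enough vertices in its bags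
  let P : Finset ι → Prop := fun S =>
    (D.tree.induce (S : Set ι)).Connected ∧ S.card ≤ (S.biUnion D.bag).card
  obtain ⟨S, hS⟩ := (Finset.univ.filter P).exists_maximal (by
    obtain ⟨v⟩ := ‹Nonempty V›
    obtain ⟨r, hr⟩ := D.exists_mem_bag v
    refine ⟨{r}, Finset.mem_filter.2 ⟨Finset.mem_univ _, ?_, ?_⟩⟩
    · rw [Finset.coe_singleton]
      exact connected_singleton r
    · simpa using Finset.card_pos.2 ⟨v, hr⟩)
  obtain ⟨hSc, hScard⟩ := (Finset.mem_filter.1 hS.1).2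
  by_cases huniv : ∀ x, x ∈ S
  · rw [← Finset.card_univ, ← Finset.eq_univ_iff_forall.2 huniv]
    exact hScard.trans (Finset.card_le_univ _)
  · exfalso
    push Not at huniv
    obtain ⟨y, hy⟩ := huniv
    obtain ⟨x⟩ := hSc.nonempty
    obtain ⟨a, -, t, -, hat, ha, ht⟩ := exists_crossing_edge
      (connected_induce_univ D.isTree.connected) (P := fun z => z ∈ S) trivial x.2
      (Set.mem_univ y) hy
    obtain ⟨v, hvt, hva⟩ := Finset.not_subset.1 (h t a hat.symm)
    have hnew : v ∉ S.biUnion D.bag := by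
      intro hv
      obtain ⟨z, hz, hvz⟩ := Finset.mem_biUnion.1 hv
      -- otherwise the bags of `v` would join `t` to `S` by an edge other than the one to `a`
      obtain ⟨Y, hY, htY⟩ := exists_isComponentOf (T := D.tree)
        (S := Finset.univ.filter (fun x => v ∈ D.bag x) \ S) (x := t) (by simp [hvt, ht])
      obtain ⟨b, hb, c, hc, hbc, hbY, hcY⟩ := exists_crossing_edge (D.connected_bags v)
        (P := fun x => x ∈ Y) hvt htY hvz (fun hzY => (Finset.mem_sdiff.1 (hY.1 hzY)).2 hz)
      have hcS : c ∈ S := by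
        by_contra hcS
        exact hcY (hY.2.2 b hbY c (by simpa [hcS] using hc) hbc)
      have : a = c := eq_of_adj_of_disjoint_connected D.isTree.isAcyclic hSc hY.2.1
        (Set.disjoint_left.2 fun z hz hzY => (Finset.mem_sdiff.1 (hY.1 hzY)).2 hz)
        ha hcS htY hbY hat hbc.symm
      exact hva (this ▸ hc)
    have hins : P (insert t S) := by
      refine ⟨connected_insert hSc ha hat, ?_⟩
      rw [Finset.card_insert_of_notMem ht, Finset.biUnion_insert]
      calc S.card + 1 ≤ (S.biUnion D.bag).card + 1 := by omega
        _ = (insert v (S.biUnion D.bag)).card := (Finset.card_insert_of_notMem hnew).symm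
        _ ≤ _ := Finset.card_le_card (Finset.insert_subset
          (Finset.mem_union_left _ hvt) Finset.subset_union_right)
    exact ht (hS.2 (Finset.mem_filter.2 ⟨Finset.mem_univ _, hins⟩) (Finset.subset_insert t S)
      (Finset.mem_insert_self t S))

end Contraction

section Existence

theorem treewidth_le_width {V : Type*} {G : SimpleGraph V} {N : ℕ}
    (D : TreeDecomposition G (Fin N)) : treewidth G ≤ D.width :=
  Nat.sInf_le ⟨N, D, rfl⟩

variable {V : Type*} [Fintype V]

theorem exists_treeDecomposition_width_eq_treewidth (G : SimpleGraph V) :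
    ∃ (N : ℕ) (D : TreeDecomposition G (Fin N)), D.width = treewidth G := by
  refine Nat.sInf_mem (s := {k | ∃ (N : ℕ) (D : TreeDecomposition G (Fin N)), D.width = k}) ?_
  let D : TreeDecomposition G (Fin 1) :=
    { tree := ⊥
      isTree := SimpleGraph.IsTree.of_subsingleton
      bag := fun _ => Finset.univ
      exists_mem_bag := fun v => ⟨0, Finset.mem_univ v⟩
      exists_edge_bag := fun u v _ => ⟨0, Finset.mem_univ u, Finset.mem_univ v⟩
      connected_bags := fun v => by
        have : Nonempty {t : Fin 1 | v ∈ (Finset.univ : Finset V)} := ⟨⟨0, Finset.mem_univ v⟩⟩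
        exact SimpleGraph.Connected.mk
          fun a b => Subsingleton.elim a b ▸ SimpleGraph.Reachable.refl _ }
  exact ⟨D.width, 1, D, rfl⟩

/-- Some tree decomposition of minimum width has at most as many nodes as there are vertices:
one with the least number of nodes, since there no edge can be contracted. -/
theorem exists_small_treeDecomposition [Nonempty V] (G : SimpleGraph V) :
    ∃ (N : ℕ) (D : TreeDecomposition G (Fin N)), D.width = treewidth G ∧
      N ≤ Fintype.card V := by
  classical
  have hex := exists_treeDecomposition_width_eq_treewidth G
  obtain ⟨D, hD⟩ := Nat.find_spec hex
  refine ⟨Nat.find hex, D, hD, ?_⟩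
  have h := D.card_le_of_not_subset fun s t hst hsub => by
    obtain ⟨M, hM, D', hD'⟩ := D.exists_contraction_fin hst hsub
    exact Nat.find_min hex hM ⟨D', le_antisymm (hD'.trans hD.le) (treewidth_le_width D')⟩
  simpa using h

theorem exists_isCentroidRanking [Nonempty V] (G : SimpleGraph V) :
    ∃ R : V → ℕ, IsCentroidRanking G 1 R := by
  obtain ⟨N, D, hD, hN⟩ := exists_small_treeDecomposition G
  obtain ⟨depth, hdepth⟩ := exists_isCentroidDecomposition D.isTree.isAcyclic Finset.univ
    (by rw [Finset.coe_univ]; exact connected_induce_univ D.isTree.connected) 0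
  -- order by the least depth, and break ties by an enumeration of the vertices
  let e := Fintype.equivFin V
  let M := Finset.univ.sup (D.minDepth depth)
  have hM : ∀ v, D.minDepth depth v ≤ M := fun v => Finset.le_sup (Finset.mem_univ v)
  have hlt : ∀ u v, D.minDepth depth u < D.minDepth depth v →
      (M - D.minDepth depth v) * Fintype.card V + e v <
        (M - D.minDepth depth u) * Fintype.card V + e u := by
    intro u v huv
    have h1 : M - D.minDepth depth v + 1 ≤ M - D.minDepth depth u := by
      have := hM v
      omega
    have h2 := Nat.mul_le_mul_right (Fintype.card V) h1
    have h3 := (e v).2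
    rw [add_mul, one_mul] at h2
    omega
  refine ⟨fun v => (M - D.minDepth depth v) * Fintype.card V + e v, ?_, N, D, depth,
    by simpa using hN, hD, hdepth, hlt⟩
  intro u v huv
  rcases lt_trichotomy (D.minDepth depth u) (D.minDepth depth v) with h | h | h
  · exact absurd huv (hlt u v h).ne'
  · simp only [h, add_right_inj] at huv
    exact e.injective (Fin.ext huv)
  · exact absurd huv (hlt v u h).ne

end Existence

/-! ### Few potential hubs -/

section HubSets

/-- `x` can be reached from `h` by a walk on which no vertex is ranked higher than `h`. -/
def LowReach {V : Type*} (G : SimpleGraph V) (R : V → ℕ) (h x : V) : Prop :=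
  Relation.ReflTransGen (fun a b => G.Adj a b ∧ R b ≤ R h) h x

theorem LowReach.rank_le {V : Type*} {G : SimpleGraph V} {R : V → ℕ} {h x : V}
    (hx : LowReach G R h x) : R x ≤ R h := by
  induction hx with
  | refl => exact le_rfl
  | tail _ h2 _ => exact h2.2

theorem TreeDecomposition.minDepth_le {V ι : Type*} {G : SimpleGraph V}
    (D : TreeDecomposition G ι) (depth : ι → ℕ) {v : V} {t : ι} (h : v ∈ D.bag t) :
    D.minDepth depth v ≤ depth t :=
  Nat.sInf_le ⟨t, h, rfl⟩

theorem TreeDecomposition.exists_minDepth_eq {V ι : Type*} {G : SimpleGraph V}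
    (D : TreeDecomposition G ι) (depth : ι → ℕ) (v : V) :
    ∃ t, v ∈ D.bag t ∧ depth t = D.minDepth depth v := by
  obtain ⟨t, ht⟩ := D.exists_mem_bag v
  obtain ⟨t', ht', he⟩ := Nat.sInf_mem (s := depth '' {t | v ∈ D.bag t}) ⟨_, t, ht, rfl⟩
  exact ⟨t', ht', he⟩

variable {ι : Type*} [DecidableEq ι]

theorem IsCentroidDecomposition.le_depth {T : SimpleGraph ι} {depth : ι → ℕ} {S : Finset ι}
    {d : ℕ} (h : IsCentroidDecomposition T depth S d) : ∀ x ∈ S, d ≤ depth x := by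
  induction h with
  | root S d c mem depth_eq half below ih =>
    intro x hx
    by_cases hxc : x = c
    · exact hxc ▸ depth_eq.ge
    · obtain ⟨C, hC, hxC⟩ := exists_isComponentOf (T := T) (Finset.mem_erase.2 ⟨hxc, hx⟩)
      exact (Nat.le_succ d).trans (ih C hC x hxC)

variable {V : Type*} [DecidableEq V] {G : SimpleGraph V} {R : V → ℕ}

/-- The heart of the label bound. In a part `S` of a centroid decomposition with root `c`, take two
vertices all of whose bags lie in `S`, one of which is linked to the other by a walk of lower ranked
vertices. Either one of them is in the bag of `c`, or both live in the same component of `S`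
without `c`. Hence the bags of at most `log₂ |S| + 1` roots account for all such pairs. -/
theorem IsCentroidDecomposition.exists_hubSets {D : TreeDecomposition G ι} {depth : ι → ℕ}
    (hR : ∀ u v, D.minDepth depth u < D.minDepth depth v → R v < R u) {b : ℕ}
    (hb : ∀ t, (D.bag t).card ≤ b) {S : Finset ι} {d : ℕ}
    (h : IsCentroidDecomposition D.tree depth S d) :
    ∀ k : ℕ, S.card < 2 ^ k → (∀ x ∈ S, ∀ y, y ∉ S → D.tree.Adj x y → depth y < d) →
      ∃ A : V → Finset V, (∀ v, (A v).card ≤ b * k) ∧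
        ∀ h v, (∀ t, h ∈ D.bag t → t ∈ S) → (∀ t, v ∈ D.bag t → t ∈ S) →
          (LowReach G R h v → h ∈ A v) ∧
          ∀ x, LowReach G R h x → G.Adj x v → h ∈ A v ∨ v ∈ A h := by
  induction h with
  | root S d c mem depth_eq half below ih =>
  intro k hk hbd
  obtain _ | k := k
  · exact absurd (Finset.card_pos.2 ⟨c, mem⟩) (by simpa using hk)
  have hbdC : ∀ C, IsComponentOf D.tree (S.erase c) C → ∀ x ∈ C, ∀ y, y ∉ C →
      D.tree.Adj x y → depth y < d + 1 := by
    intro C hC x hx y hy hxy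
    by_cases hyS : y ∈ S
    · by_cases hyc : y = c
      · rw [hyc, depth_eq]
        exact Nat.lt_succ_self d
      · exact absurd (hC.2.2 x hx y (Finset.mem_erase.2 ⟨hyc, hyS⟩) hxy) hy
    · exact (hbd x (Finset.mem_of_mem_erase (hC.1 hx)) y hyS hxy).trans (Nat.lt_succ_self d)
  have hex : ∀ C, IsComponentOf D.tree (S.erase c) C →
      ∃ A : V → Finset V, (∀ v, (A v).card ≤ b * k) ∧
        ∀ h v, (∀ t, h ∈ D.bag t → t ∈ C) → (∀ t, v ∈ D.bag t → t ∈ C) →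
          (LowReach G R h v → h ∈ A v) ∧
          ∀ x, LowReach G R h x → G.Adj x v → h ∈ A v ∨ v ∈ A h := by
    intro C hC
    refine ih C hC k ?_ (hbdC C hC)
    have := half C hC
    rw [pow_succ] at hk
    omega
  choose! f hfcard hf using hex
  classical
  let In : V → Finset ι → Prop := fun v C =>
    IsComponentOf D.tree (S.erase c) C ∧ ∀ t, v ∈ D.bag t → t ∈ C
  let A : V → Finset V := fun v =>
    D.bag c ∪ if h : ∃ C, In v C then f h.choose v else ∅
  have hA : ∀ v C, In v C → f C v ⊆ A v := by
    intro v C hC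
    have h : ∃ C, In v C := ⟨C, hC⟩
    obtain ⟨t, ht⟩ := D.exists_mem_bag v
    have : h.choose = C :=
      h.choose_spec.1.eq_of_mem hC.1 (h.choose_spec.2 t ht) (hC.2 t ht)
    simp only [A, dif_pos h, this]
    exact Finset.subset_union_right
  have hcA : ∀ v, D.bag c ⊆ A v := fun v => Finset.subset_union_left
  refine ⟨A, fun v => ?_, ?_⟩
  · refine (Finset.card_union_le _ _).trans ?_
    have h1 : (if h : ∃ C, In v C then f h.choose v else ∅).card ≤ b * k := by
      split_ifs with h
      · exact hfcard _ h.choose_spec.1 v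
      · simp
    have h2 := hb c
    rw [Nat.mul_succ]
    omega
  · intro h v hh hv
    by_cases hX : h ∈ D.bag c
    · exact ⟨fun _ => hcA v hX, fun _ _ _ => Or.inl (hcA v hX)⟩
    -- the bags of `h` lie in one component `C` of `S` without `c`
    obtain ⟨t₀, ht₀⟩ := D.exists_mem_bag h
    have hne : ∀ t, h ∈ D.bag t → t ≠ c := fun t ht htc => hX (htc ▸ ht)
    obtain ⟨C, hC, htC⟩ := exists_isComponentOf (T := D.tree)
      (Finset.mem_erase.2 ⟨hne t₀ ht₀, hh t₀ ht₀⟩)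
    have hhC : ∀ t, h ∈ D.bag t → t ∈ C :=
      hC.subset_of_connected (D.connected_bags h)
        (fun t ht => Finset.mem_erase.2 ⟨hne t ht, hh t ht⟩) htC ht₀
    have hdepth : d + 1 ≤ D.minDepth depth h := by
      obtain ⟨t, ht, he⟩ := D.exists_minDepth_eq depth h
      exact he ▸ (below C hC).le_depth t (hhC t ht)
    have hlow : ∀ x, R x ≤ R h → d + 1 ≤ D.minDepth depth x := fun x hx =>
      hdepth.trans (not_lt.1 fun hlt => (hR _ _ hlt).not_ge hx)
    -- a vertex that is not ranked higher than `h` cannot leave `C`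
    have hreach : ∀ x, LowReach G R h x → ∀ t, x ∈ D.bag t → t ∈ C := by
      intro x hx
      induction hx with
      | refl => exact hhC
      | @tail y x _ hyx ih' =>
        obtain ⟨t, hty, htx⟩ := D.exists_edge_bag y x hyx.1
        refine forall_mem_of_connected (D.connected_bags x) (P := fun t => t ∈ C) htx
          (ih' t hty) ?_
        intro s _ t ht hst hs
        by_contra htC'
        have h1 := hbdC C hC s hs t htC' hst
        have h2 := (hlow x hyx.2).trans (D.minDepth_le depth ht)
        omega
    constructor
    · intro hv'
      exact hA v C ⟨hC, hreach v hv'⟩ ((hf C hC h v hhC (hreach v hv')).1 hv')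
    · intro x hx hxv
      by_cases hvX : v ∈ D.bag c
      · exact Or.inr (hcA h hvX)
      obtain ⟨t, htx, htv⟩ := D.exists_edge_bag x v hxv
      have hvC : ∀ t, v ∈ D.bag t → t ∈ C :=
        hC.subset_of_connected (D.connected_bags v)
          (fun t ht => Finset.mem_erase.2 ⟨fun htc => hvX (htc ▸ ht), hv t ht⟩)
          (hreach x hx t htx) htv
      exact ((hf C hC h v hhC hvC).2 x hx hxv).imp (fun h' => hA v C ⟨hC, hvC⟩ h')
        (fun h' => hA h C ⟨hC, hhC⟩ h')

/-- Potential hubs: a search from `h` that only expands vertices of lower rank labels `v` only if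
`h ∈ A v`, and pops `v` only if `h ∈ A v` or `v ∈ A h`. -/
structure HubSets {V : Type*} (G : SimpleGraph V) (R : V → ℕ) (B : ℕ) where
  A : V → Finset V
  card_le : ∀ v, (A v).card ≤ B
  mem_of_lowReach : ∀ h v, LowReach G R h v → h ∈ A v
  mem_of_adj : ∀ h x v, LowReach G R h x → G.Adj x v → h ∈ A v ∨ v ∈ A h

theorem IsCentroidRanking.exists_hubSets [Fintype V] {K : ℕ} (h : IsCentroidRanking G K R) :
    Nonempty (HubSets G R
      ((treewidth G + 1) * ((K + 1) * (Nat.log 2 (Fintype.card V) + 1)))) := by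
  obtain ⟨-, N, D, depth, hN, hD, hdec, hR⟩ := h
  have hbag : ∀ t, (D.bag t).card ≤ treewidth G + 1 := by
    intro t
    have h1 := Finset.le_sup (f := fun t => (D.bag t).card) (Finset.mem_univ t)
    rw [← hD, TreeDecomposition.width]
    omega
  have hcard : (Finset.univ : Finset (Fin N)).card <
      2 ^ ((K + 1) * (Nat.log 2 (Fintype.card V) + 1)) := by
    rw [Finset.card_fin]
    have h1 : Fintype.card V < 2 ^ (Nat.log 2 (Fintype.card V) + 1) :=
      Nat.lt_pow_succ_log_self (by norm_num) _
    calc N ≤ Fintype.card V ^ K := hN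
      _ ≤ (2 ^ (Nat.log 2 (Fintype.card V) + 1)) ^ K := Nat.pow_le_pow_left h1.le K
      _ = 2 ^ (K * (Nat.log 2 (Fintype.card V) + 1)) := by rw [← pow_mul, mul_comm]
      _ < _ := Nat.pow_lt_pow_right (by norm_num) (by
        rw [add_mul, one_mul]
        omega)
  obtain ⟨A, hA, hA'⟩ := hdec.exists_hubSets hR hbag _ hcard (by simp)
  exact ⟨⟨A, hA, fun h v => (hA' h v (by simp) (by simp)).1,
    fun h x v => (hA' h v (by simp) (by simp)).2 x⟩⟩

end HubSets

/-! ### Shortest path distances and canonical hubs -/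

section Distance

variable {V : Type*} {G : SimpleGraph V} {wt : Sym2 V → ℝ≥0}

theorem weightedDist_le_walkLength {u v : V} (q : G.Walk u v) :
    weightedDist G wt u v ≤ walkLength wt q :=
  iInf_le _ q

@[simp] theorem walkLength_nil {u : V} :
    walkLength wt (SimpleGraph.Walk.nil : G.Walk u u) = 0 := rfl

@[simp] theorem walkLength_cons {u v w : V} (h : G.Adj u v) (q : G.Walk v w) :
    walkLength wt (SimpleGraph.Walk.cons h q) = wt s(u, v) + walkLength wt q := by
  simp [walkLength]

theorem walkLength_append {u v w : V} (q : G.Walk u v) (q' : G.Walk v w) :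
    walkLength wt (q.append q') = walkLength wt q + walkLength wt q' := by
  simp [walkLength]

theorem walkLength_reverse {u v : V} (q : G.Walk u v) :
    walkLength wt q.reverse = walkLength wt q := by
  simp [walkLength, List.sum_reverse]

theorem weightedDist_comm (u v : V) : weightedDist G wt u v = weightedDist G wt v u := by
  have key : ∀ u v : V, weightedDist G wt u v ≤ weightedDist G wt v u := fun u v =>
    le_iInf fun q => walkLength_reverse (wt := wt) q ▸ weightedDist_le_walkLength q.reverse
  exact le_antisymm (key u v) (key v u)

theorem weightedDist_self (u : V) : weightedDist G wt u u = 0 :=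
  le_antisymm (by simpa using weightedDist_le_walkLength (wt := wt) (.nil : G.Walk u u)) bot_le

theorem weightedDist_triangle (u v w : V) :
    weightedDist G wt u w ≤ weightedDist G wt u v + weightedDist G wt v w := by
  unfold weightedDist
  refine ENNReal.le_iInf_add_iInf fun q q' => ?_
  have h := weightedDist_le_walkLength (wt := wt) (q.append q')
  rw [walkLength_append] at h
  exact_mod_cast h

theorem weightedDist_le_of_adj {v u : V} (h : G.Adj v u) :
    weightedDist G wt v u ≤ wt s(v, u) := by
  simpa using weightedDist_le_walkLength (wt := wt) (SimpleGraph.Walk.cons h .nil)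

/-- In a finite graph a shortest walk exists: bypassing closed detours does not make a walk longer,
and there are only finitely many paths. -/
theorem exists_walkLength_eq_weightedDist [Finite V] {u v : V} (h : weightedDist G wt u v ≠ ⊤) :
    ∃ q : G.Walk u v, (walkLength wt q : ℝ≥0∞) = weightedDist G wt u v := by
  classical
  have hne : Nonempty (G.Walk u v) := by
    by_contra hno
    rw [not_nonempty_iff] at hno
    exact h (iInf_of_empty _)
  have := Fintype.ofFinite V
  obtain ⟨q₀⟩ := hne
  have hpne : Nonempty (G.Path u v) := ⟨q₀.toPath⟩
  obtain ⟨q, hq⟩ := Finite.exists_min fun q : G.Path u v => walkLength wt q.1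
  refine ⟨q.1, le_antisymm (le_iInf fun q' => ?_) (weightedDist_le_walkLength q.1)⟩
  have h1 : walkLength wt q'.bypass ≤ walkLength wt q' :=
    (q'.edges_bypass_sublist_edges.map wt).sum_le_sum fun _ _ => zero_le
  exact_mod_cast (hq q'.toPath).trans h1

/-- `h` is a canonical hub of `v`: `h` and `v` are connected, and `h` has the highest rank among
all vertices on shortest paths from `h` to `v`. -/
def Canonical (G : SimpleGraph V) (wt : Sym2 V → ℝ≥0) (R : V → ℕ) (h v : V) : Prop :=
  weightedDist G wt h v ≠ ⊤ ∧
    ∀ x, weightedDist G wt h x + weightedDist G wt x v ≤ weightedDist G wt h v → R x ≤ R h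

variable {R : V → ℕ}

theorem Canonical.rank_le {h v : V} (hc : Canonical G wt R h v) : R v ≤ R h :=
  hc.2 v (by simp [weightedDist_self])

/-- Vertices on a shortest path to a vertex with canonical hub `h` have canonical hub `h`. -/
theorem Canonical.of_le {h v z : V} (hc : Canonical G wt R h v)
    (hz : weightedDist G wt h z + weightedDist G wt z v ≤ weightedDist G wt h v) :
    Canonical G wt R h z := by
  refine ⟨fun htop => hc.1 (top_le_iff.1 (by rw [htop, top_add] at hz; exact hz)),
    fun x hx => hc.2 x ?_⟩
  calc weightedDist G wt h x + weightedDist G wt x v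
      ≤ weightedDist G wt h x + (weightedDist G wt x z + weightedDist G wt z v) :=
        add_le_add_right (weightedDist_triangle x z v) _
    _ = weightedDist G wt h x + weightedDist G wt x z + weightedDist G wt z v :=
        (add_assoc _ _ _).symm
    _ ≤ weightedDist G wt h z + weightedDist G wt z v := add_le_add_left hx _
    _ ≤ _ := hz

/-- The highest ranked vertex on the shortest paths between two connected vertices is a canonical
hub of both. -/
theorem exists_canonical_hub [Finite V] {u v : V} (h : weightedDist G wt u v ≠ ⊤) :
    ∃ x, Canonical G wt R x u ∧ Canonical G wt R x v ∧ R u ≤ R x ∧ R v ≤ R x ∧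
      weightedDist G wt u x + weightedDist G wt x v = weightedDist G wt u v := by
  let X : Set V := {x | weightedDist G wt u x + weightedDist G wt x v ≤ weightedDist G wt u v}
  have huX : u ∈ X := by simp [X, weightedDist_self]
  have hvX : v ∈ X := by simp [X, weightedDist_self]
  obtain ⟨x, hx, hmax⟩ := X.toFinite.exists_maximalFor R X ⟨u, huX⟩
  have hmax' : ∀ y ∈ X, R y ≤ R x := fun y hy =>
    (le_total (R y) (R x)).elim id fun hle => hmax hy hle
  have hxe := le_antisymm hx (weightedDist_triangle u x v)
  refine ⟨x, ⟨?_, fun y hy => hmax' y ?_⟩, ⟨?_, fun y hy => hmax' y ?_⟩,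
    hmax' u huX, hmax' v hvX, hxe⟩
  · intro htop
    rw [weightedDist_comm, htop, top_add] at hxe
    exact h hxe.symm
  · calc weightedDist G wt u y + weightedDist G wt y v
        ≤ weightedDist G wt u y + (weightedDist G wt y x + weightedDist G wt x v) :=
          add_le_add_right (weightedDist_triangle y x v) _
      _ = (weightedDist G wt x y + weightedDist G wt y u) + weightedDist G wt x v := by
          rw [← add_assoc, weightedDist_comm u y, weightedDist_comm y x,
            add_comm (weightedDist G wt y u)]
      _ ≤ weightedDist G wt x u + weightedDist G wt x v := add_le_add_left hy _
      _ ≤ _ := by rw [weightedDist_comm x u]; exact hx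
  · intro htop
    rw [htop, add_top] at hxe
    exact h hxe.symm
  · calc weightedDist G wt u y + weightedDist G wt y v
        ≤ weightedDist G wt u x + weightedDist G wt x y + weightedDist G wt y v :=
          add_le_add_left (weightedDist_triangle u x y) _
      _ = weightedDist G wt u x + (weightedDist G wt x y + weightedDist G wt y v) :=
          add_assoc _ _ _
      _ ≤ weightedDist G wt u x + weightedDist G wt x v := add_le_add_right hy _
      _ ≤ _ := hx

end Distance

/-! ### Queries on label sets -/

section Queries

variable {V : Type*}

theorem distQuery_snd_le (table : V → Option ℝ≥0) (δ : ℝ≥0) (l : List (V × ℝ≥0)) :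
    (distQuery table δ l).2 ≤ l.length + 1 := by
  induction l with
  | nil => simp [distQuery]
  | cons a l ih =>
    obtain ⟨h, d⟩ := a
    rw [distQuery]
    split
    · simpa using ih
    · split_ifs
      · simp
      · simpa using ih

theorem one_le_distQuery_snd (table : V → Option ℝ≥0) (δ : ℝ≥0) (l : List (V × ℝ≥0)) :
    1 ≤ (distQuery table δ l).2 := by
  cases l with
  | nil => simp [distQuery]
  | cons a l =>
    rw [distQuery]
    split
    · simp
    · split_ifs <;> simp

theorem distQuery_eq_true_iff (table : V → Option ℝ≥0) (δ : ℝ≥0) (l : List (V × ℝ≥0)) :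
    (distQuery table δ l).1 = true ↔ ∃ h d d', (h, d) ∈ l ∧ table h = some d' ∧ d + d' ≤ δ := by
  induction l with
  | nil => simp [distQuery]
  | cons a l ih =>
    obtain ⟨h, d⟩ := a
    rw [distQuery]
    split
    · rename_i hn
      rw [ih]
      constructor
      · rintro ⟨h', d1, d2, h1, h2⟩
        exact ⟨h', d1, d2, List.mem_cons_of_mem _ h1, h2⟩
      · rintro ⟨h', d1, d2, h1, h2, h3⟩
        rcases List.mem_cons.1 h1 with h4 | h4
        · cases h4
          rw [hn] at h2
          cases h2
        · exact ⟨h', d1, d2, h4, h2, h3⟩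
    · rename_i d' hn
      split_ifs with hle
      · simp only [true_iff]
        exact ⟨h, d, d', List.mem_cons_self, hn, hle⟩
      · rw [ih]
        constructor
        · rintro ⟨h', d1, d2, h1, h2⟩
          exact ⟨h', d1, d2, List.mem_cons_of_mem _ h1, h2⟩
        · rintro ⟨h', d1, d2, h1, h2, h3⟩
          rcases List.mem_cons.1 h1 with h4 | h4
          · cases h4
            rw [hn] at h2
            cases h2
            exact absurd h3 hle
          · exact ⟨h', d1, d2, h4, h2, h3⟩

/-- A list with distinct hubs contains at most one label per hub. -/
theorem label_unique {l : List (V × ℝ≥0)} (hl : (l.map Prod.fst).Nodup) {h : V} {d d' : ℝ≥0}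
    (hd : (h, d) ∈ l) (hd' : (h, d') ∈ l) : d = d' :=
  congrArg Prod.snd (List.inj_on_of_nodup_map hl hd hd' rfl)

variable [DecidableEq V]

theorem mem_of_hashLabels_eq_some {l : List (V × ℝ≥0)} {h : V} {d : ℝ≥0}
    (hd : hashLabels l h = some d) : (h, d) ∈ l := by
  unfold hashLabels at hd
  obtain ⟨a, ha, rfl⟩ := Option.map_eq_some_iff.1 hd
  have h1 := List.find?_some ha
  have h2 := List.mem_of_find?_eq_some ha
  simp only [decide_eq_true_eq] at h1
  exact h1 ▸ h2

theorem hashLabels_eq_some {l : List (V × ℝ≥0)} (hl : (l.map Prod.fst).Nodup) {h : V} {d : ℝ≥0}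
    (hd : (h, d) ∈ l) : hashLabels l h = some d := by
  cases he : hashLabels l h with
  | some d' => rw [label_unique hl hd (mem_of_hashLabels_eq_some he)]
  | none =>
    unfold hashLabels at he
    rw [Option.map_eq_none_iff, List.find?_eq_none] at he
    simpa using he _ hd

theorem ncard_hashLabels_le (l : List (V × ℝ≥0)) :
    {v | hashLabels l v ≠ none}.ncard ≤ l.length := by
  have hsub : {v | hashLabels l v ≠ none} ⊆ ((l.map Prod.fst).toFinset : Set V) := by
    intro v hv
    obtain ⟨d, hd⟩ := Option.ne_none_iff_exists'.1 hv
    simpa using ⟨d, mem_of_hashLabels_eq_some hd⟩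
  refine (Set.ncard_le_ncard hsub (Finset.finite_toSet _)).trans ?_
  rw [Set.ncard_coe_finset]
  exact (List.toFinset_card_le _).trans (by simp)

variable (R : V → ℕ)

theorem cleanQuery_snd_le (h : V) (δ : ℝ≥0) (l l' : List (V × ℝ≥0)) :
    (cleanQuery R h δ l l').2 ≤ l.length + l'.length + 1 := by
  induction l, l' using cleanQuery.induct R δ with
  | case1 => simp [cleanQuery]
  | case2 => simp [cleanQuery]
  | case3 _ _ _ _ _ hle =>
    rw [cleanQuery, if_pos rfl, if_pos hle]
    omega
  | case4 _ _ _ _ _ hle ih =>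
    rw [cleanQuery, if_pos rfl, if_neg hle]
    simp only [List.length_cons] at *
    omega
  | case5 _ _ _ _ _ _ hne hlt ih =>
    rw [cleanQuery, if_neg hne, if_pos hlt]
    simp only [List.length_cons] at *
    omega
  | case6 _ _ _ _ _ _ hne hlt ih =>
    rw [cleanQuery, if_neg hne, if_neg hlt]
    simp only [List.length_cons] at *
    omega

/-- A label is only deleted in favor of a common hub of higher rank. -/
theorem exists_of_cleanQuery_eq_true {h : V} {δ : ℝ≥0} {l l' : List (V × ℝ≥0)}
    (hq : (cleanQuery R h δ l l').1 = true) :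
    ∃ a da db, (a, da) ∈ l ∧ (a, db) ∈ l' ∧ da + db ≤ δ ∧ R h < R a := by
  induction l, l' using cleanQuery.induct R δ with
  | case1 => simp [cleanQuery] at hq
  | case2 => simp [cleanQuery] at hq
  | case3 da l a db l' hle =>
    rw [cleanQuery, if_pos rfl, if_pos hle] at hq
    exact ⟨a, da, db, List.mem_cons_self, List.mem_cons_self, hle, by simpa using hq⟩
  | case4 da l a db l' hle ih =>
    rw [cleanQuery, if_pos rfl, if_neg hle] at hq
    obtain ⟨c, d1, d2, h1, h2, h3⟩ := ih hq
    exact ⟨c, d1, d2, List.mem_cons_of_mem _ h1, List.mem_cons_of_mem _ h2, h3⟩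
  | case5 a da l b db l' hne hlt ih =>
    rw [cleanQuery, if_neg hne, if_pos hlt] at hq
    obtain ⟨c, d1, d2, h1, h2, h3⟩ := ih hq
    exact ⟨c, d1, d2, List.mem_cons_of_mem _ h1, h2, h3⟩
  | case6 a da l b db l' hne hlt ih =>
    rw [cleanQuery, if_neg hne, if_neg hlt] at hq
    obtain ⟨c, d1, d2, h1, h2, h3⟩ := ih hq
    exact ⟨c, d1, d2, h1, List.mem_cons_of_mem _ h2, h3⟩

theorem ppsdQuery_snd_le (l l' : List (V × ℝ≥0)) :
    (ppsdQuery R l l').2 ≤ l.length + l'.length + 1 := by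
  induction l, l' using ppsdQuery.induct R with
  | case1 => simp [ppsdQuery]
  | case2 => simp [ppsdQuery]
  | case3 _ _ _ _ _ ih =>
    rw [ppsdQuery, if_pos rfl]
    simp only [List.length_cons] at *
    omega
  | case4 _ _ _ _ _ _ hne hlt ih =>
    rw [ppsdQuery, if_neg hne, if_pos hlt]
    simp only [List.length_cons] at *
    omega
  | case5 _ _ _ _ _ _ hne hlt ih =>
    rw [ppsdQuery, if_neg hne, if_neg hlt]
    simp only [List.length_cons] at *
    omega

theorem le_ppsdQuery {m : ℝ≥0∞} {l l' : List (V × ℝ≥0)}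
    (hm : ∀ a da db, (a, da) ∈ l → (a, db) ∈ l' → m ≤ ((da + db : ℝ≥0) : ℝ≥0∞)) :
    m ≤ (ppsdQuery R l l').1 := by
  induction l, l' using ppsdQuery.induct R with
  | case1 => simp [ppsdQuery]
  | case2 => simp [ppsdQuery]
  | case3 da l a db l' ih =>
    rw [ppsdQuery, if_pos rfl]
    exact le_min (hm a da db List.mem_cons_self List.mem_cons_self)
      (ih fun c d1 d2 h1 h2 => hm c d1 d2 (List.mem_cons_of_mem _ h1) (List.mem_cons_of_mem _ h2))
  | case4 a da l b db l' hne hlt ih =>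
    rw [ppsdQuery, if_neg hne, if_pos hlt]
    exact ih fun c d1 d2 h1 h2 => hm c d1 d2 (List.mem_cons_of_mem _ h1) h2
  | case5 a da l b db l' hne hlt ih =>
    rw [ppsdQuery, if_neg hne, if_neg hlt]
    exact ih fun c d1 d2 h1 h2 => hm c d1 d2 h1 (List.mem_cons_of_mem _ h2)

/-- On sorted label sets the merge meets every common hub. -/
theorem ppsdQuery_le (hR : Function.Injective R) {l l' : List (V × ℝ≥0)}
    (hl : l.Pairwise fun a b => R b.1 < R a.1) (hl' : l'.Pairwise fun a b => R b.1 < R a.1)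
    {x : V} {d d' : ℝ≥0} (hd : (x, d) ∈ l) (hd' : (x, d') ∈ l') :
    (ppsdQuery R l l').1 ≤ ((d + d' : ℝ≥0) : ℝ≥0∞) := by
  induction l, l' using ppsdQuery.induct R with
  | case1 => simp at hd
  | case2 => simp at hd'
  | case3 da l a db l' ih =>
    rw [ppsdQuery, if_pos rfl]
    rw [List.pairwise_cons] at hl hl'
    rcases List.mem_cons.1 hd with h1 | h1
    · rcases List.mem_cons.1 hd' with h2 | h2
      · cases h1
        cases h2
        exact min_le_left _ _
      · cases h1
        exact absurd (hl'.1 _ h2) (lt_irrefl _)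
    · rcases List.mem_cons.1 hd' with h2 | h2
      · cases h2
        exact absurd (hl.1 _ h1) (lt_irrefl _)
      · exact (min_le_right _ _).trans (ih hl.2 hl'.2 h1 h2)
  | case4 a da l b db l' hne hlt ih =>
    rw [ppsdQuery, if_neg hne, if_pos hlt]
    rw [List.pairwise_cons] at hl
    refine ih hl.2 hl' ?_ hd'
    rcases List.mem_cons.1 hd with h1 | h1
    · cases h1
      rcases List.mem_cons.1 hd' with h2 | h2
      · cases h2
        exact absurd rfl hne
      · exact absurd ((List.pairwise_cons.1 hl').1 _ h2) hlt.not_gt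
    · exact h1
  | case5 a da l b db l' hne hlt ih =>
    rw [ppsdQuery, if_neg hne, if_neg hlt]
    have hlt' : R a < R b := lt_of_le_of_ne (not_lt.1 hlt) fun he => hne (hR he)
    rw [List.pairwise_cons] at hl'
    refine ih hl hl'.2 hd ?_
    rcases List.mem_cons.1 hd' with h2 | h2
    · cases h2
      rcases List.mem_cons.1 hd with h1 | h1
      · cases h1
        exact absurd rfl hne
      · exact absurd ((List.pairwise_cons.1 hl).1 _ h1) hlt'.not_gt
    · exact h2

end Queries

/-! ### The invariant of a pruned Dijkstra search -/

section SearchInvariant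

variable {V : Type*}

/-- The vertex has left the priority queue of the search. -/
def Search.Done (r : Search V) (v : V) : Prop :=
  r.dist v ≠ ⊤ ∧ v ∉ r.heap

/-- Invariant of a pruned Dijkstra search while the labels are `L`. The vertices in `pend` have
been popped but are neither pruned nor labelled yet, and `todo z z'` says that the edge from `z` to
`z'` is still to be relaxed. `complete` says that the searches of all higher ranked roots were
finished when this one started; `B` bounds the size of the hash table. -/
structure SearchInv (G : SimpleGraph V) (wt : Sym2 V → ℝ≥0) (R : V → ℕ) (complete : Prop) (B : ℕ)
    (L : Labeling V) (r : Search V) (pend : V → Prop) (todo : V → V → Prop) : Prop where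
  table_sound : ∀ x e, r.table x = some e → R r.root < R x ∧ weightedDist G wt x r.root ≤ e
  table_complete : complete → ∀ x, R r.root < R x → Canonical G wt R x r.root →
    ∃ e, r.table x = some e ∧ (e : ℝ≥0∞) = weightedDist G wt x r.root
  table_card : {x | r.table x ≠ none}.ncard ≤ B
  dist_root : r.dist r.root ≤ 0
  heap_dist : ∀ v ∈ r.heap, r.dist v ≠ ⊤
  dist_sound : ∀ v, weightedDist G wt r.root v ≤ r.dist v
  linked : ∀ v, r.dist v ≠ ⊤ → v = r.root ∨ ∃ x, LowReach G R r.root x ∧ G.Adj x v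
  fresh : ∀ v, r.dist v = ⊤ ∨ v ∈ r.heap ∨ pend v → ∀ e, (r.root, e) ∉ L v
  labelled : ∀ v, r.Done v → ¬ pend v → Canonical G wt R r.root v →
    ∃ e : ℝ≥0, (r.root, e) ∈ L v ∧ (e : ℝ≥0∞) = weightedDist G wt r.root v
  relaxed : ∀ z z', r.Done z → ¬ pend z → Canonical G wt R r.root z → G.Adj z z' →
    ¬ todo z z' → r.dist z' ≤ weightedDist G wt r.root z + wt s(z, z')
  mono : ∀ x y, r.Done x → y ∈ r.heap → r.dist x ≤ r.dist y

/-- `v` is the vertex that was popped last, at distance `d`. -/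
structure Search.Current (G : SimpleGraph V) (wt : Sym2 V → ℝ≥0) (R : V → ℕ) (r : Search V)
    (v : V) (d : ℝ≥0) : Prop where
  dist_eq : r.dist v = d
  notMem_heap : v ∉ r.heap
  done_le : ∀ x, r.Done x → r.dist x ≤ d
  exact_of_canonical : Canonical G wt R r.root v → (d : ℝ≥0∞) = weightedDist G wt r.root v

variable {G : SimpleGraph V} {wt : Sym2 V → ℝ≥0} {R : V → ℕ} {complete : Prop} {B : ℕ}
  {L L' : Labeling V} {r : Search V} {pend : V → Prop} {todo : V → V → Prop}

theorem Search.Current.done {v : V} {d : ℝ≥0} (h : r.Current G wt R v d) : r.Done v :=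
  ⟨by rw [h.dist_eq]; exact ENNReal.coe_ne_top, h.notMem_heap⟩

/-- Only the labels with the root as hub matter for a search. -/
theorem SearchInv.congr_labels (I : SearchInv G wt R complete B L r pend todo)
    (h : ∀ v e, (r.root, e) ∈ L' v ↔ (r.root, e) ∈ L v) :
    SearchInv G wt R complete B L' r pend todo :=
  { I with
    fresh := fun v hv e he => I.fresh v hv e ((h v e).1 he)
    labelled := fun v h1 h2 h3 => by
      obtain ⟨e, he, he'⟩ := I.labelled v h1 h2 h3
      exact ⟨e, (h v e).2 he, he'⟩ }

/-- A vertex with a finite distance that is not ranked higher than the root is reached from the root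
by a walk that avoids higher ranked vertices: its predecessor has been labelled. -/
theorem SearchInv.lowReach (I : SearchInv G wt R complete B L r pend todo) {v : V}
    (hv : r.dist v ≠ ⊤) (hR : R v ≤ R r.root) : LowReach G R r.root v := by
  rcases I.linked v hv with h | ⟨x, hx, hxv⟩
  · rw [h]
    exact .refl
  · exact hx.tail ⟨hxv, hR⟩

/-- The correctness of Dijkstra's algorithm: as long as a vertex with canonical hub `r.root` has
not been popped, some vertex of a shortest path to it is in the queue with its exact distance. -/
theorem SearchInv.done_or_exists_heap_le [Finite V]
    (I : SearchInv G wt R complete B L r (fun _ => False) fun _ _ => False) {v : V}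
    (hc : Canonical G wt R r.root v) :
    r.Done v ∨ ∃ y ∈ r.heap, r.dist y ≤ weightedDist G wt r.root v := by
  have hreach : ∀ (z v : V) (q : G.Walk z v), Canonical G wt R r.root v →
      weightedDist G wt r.root z + walkLength wt q ≤ weightedDist G wt r.root v →
      (r.Done z ∨ ∃ y ∈ r.heap, r.dist y ≤ weightedDist G wt r.root v) →
      r.Done v ∨ ∃ y ∈ r.heap, r.dist y ≤ weightedDist G wt r.root v := by
    intro z v q hc hq hz
    induction q with
    | nil => exact hz
    | @cons z z' v hadj q ih =>
      rcases hz with hz | hz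
      · have hzc : Canonical G wt R r.root z := hc.of_le
          ((add_le_add_right (weightedDist_le_walkLength _) _).trans hq)
        have h1 := I.relaxed z z' hz id hzc hadj id
        rw [walkLength_cons, ENNReal.coe_add, ← add_assoc] at hq
        have h2 : weightedDist G wt r.root z + wt s(z, z') ≤ weightedDist G wt r.root v :=
          le_self_add.trans hq
        refine ih hc ?_ ?_
        · refine le_trans (add_le_add_left ?_ _) hq
          exact (weightedDist_triangle _ z _).trans
            (add_le_add_right (weightedDist_le_of_adj hadj) _)
        · by_cases hh : z' ∈ r.heap
          · exact Or.inr ⟨z', hh, h1.trans h2⟩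
          · refine Or.inl ⟨fun htop => hc.1 (top_le_iff.1 ?_), hh⟩
            exact htop ▸ h1.trans h2
      · exact Or.inr hz
  obtain ⟨q, hq⟩ := exists_walkLength_eq_weightedDist hc.1
  refine hreach _ _ q hc (by rw [weightedDist_self, zero_add, hq]) ?_
  by_cases hh : r.root ∈ r.heap
  · exact Or.inr ⟨_, hh, I.dist_root.trans bot_le⟩
  · exact Or.inl ⟨fun htop => by simpa [htop] using I.dist_root, hh⟩

/-- It is safe to prune at a vertex of which the root is not a canonical hub. -/
theorem SearchInv.prune {v : V} (I : SearchInv G wt R complete B L r (fun x => x = v) todo)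
    (hv : ¬ Canonical G wt R r.root v) :
    SearchInv G wt R complete B L r (fun _ => False) todo :=
  { I with
    fresh := fun x hx => I.fresh x (hx.imp_right fun h => h.imp_right False.elim)
    labelled := fun x h1 _ h3 => I.labelled x h1 (fun h => hv (h ▸ h3)) h3
    relaxed := fun x y h1 _ h3 => I.relaxed x y h1 (fun h => hv (h ▸ h3)) h3 }

/-- The distance query is never successful at a vertex of which the root is a canonical hub: the
hub that it finds would be a higher ranked vertex on a shortest path. -/
theorem SearchInv.not_canonical_of_distQuery
    (I : SearchInv G wt R complete B L r pend todo) {v : V} {d : ℝ≥0}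
    (hcur : r.Current G wt R v d) (hL : ∀ x e, (x, e) ∈ L v → weightedDist G wt x v ≤ e)
    (hq : (distQuery r.table d (L v)).1 = true) : ¬ Canonical G wt R r.root v := by
  intro hc
  obtain ⟨x, e, e', h1, h2, h3⟩ := (distQuery_eq_true_iff _ _ _).1 hq
  obtain ⟨h4, h5⟩ := I.table_sound x e' h2
  refine (hc.2 x ?_).not_gt h4
  rw [← hcur.exact_of_canonical hc, weightedDist_comm r.root x, add_comm]
  exact (add_le_add (hL x e h1) h5).trans (by exact_mod_cast h3)

/-- If all higher ranked searches are finished, the distance query is successful at every vertex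
that is ranked higher than the root. -/
theorem SearchInv.distQuery_eq_true [Finite V]
    (I : SearchInv G wt R complete B L r pend todo) (hcomp : complete) {v : V} {d : ℝ≥0}
    (hcur : r.Current G wt R v d)
    (hL : ∀ x, R r.root < R x → Canonical G wt R x v →
      ∃ e : ℝ≥0, (x, e) ∈ L v ∧ (e : ℝ≥0∞) = weightedDist G wt x v)
    (hR : R r.root < R v) : (distQuery r.table d (L v)).1 = true := by
  have hle : weightedDist G wt r.root v ≤ d := hcur.dist_eq ▸ I.dist_sound v
  obtain ⟨x, hxr, hxv, -, hRv, hx⟩ := exists_canonical_hub (R := R)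
    (ne_top_of_le_ne_top ENNReal.coe_ne_top hle)
  obtain ⟨e, he, he'⟩ := hL x (hR.trans_le hRv) hxv
  obtain ⟨e₂, he₂, he₂'⟩ := I.table_complete hcomp x (hR.trans_le hRv) hxr
  refine (distQuery_eq_true_iff _ _ _).2 ⟨x, e, e₂, he, he₂, ?_⟩
  have h : ((e + e₂ : ℝ≥0) : ℝ≥0∞) ≤ d := by
    rw [ENNReal.coe_add, he', he₂', add_comm, weightedDist_comm x r.root, hx]
    exact hle
  exact_mod_cast h

/-- Relaxing an edge never touches a vertex that has been popped. -/
theorem Search.Current.not_done_of_lt {v u : V} {d c : ℝ≥0} (hcur : r.Current G wt R v d)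
    (h : ((d + c : ℝ≥0) : ℝ≥0∞) < r.dist u) : ¬ r.Done u := fun hu =>
  ((hcur.done_le u hu).trans (by exact_mod_cast le_self_add)).not_gt h

variable [DecidableEq V]

theorem SearchInv.start {h : V} {table : V → Option ℝ≥0}
    (hs : ∀ x e, table x = some e → R h < R x ∧ weightedDist G wt x h ≤ e)
    (hcomp : complete → ∀ x, R h < R x → Canonical G wt R x h →
      ∃ e, table x = some e ∧ (e : ℝ≥0∞) = weightedDist G wt x h)
    (hcard : {x | table x ≠ none}.ncard ≤ B) (hfresh : ∀ v e, (h, e) ∉ L v) :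
    SearchInv G wt R complete B L
      ⟨h, table, Function.update (fun _ => ⊤) h 0, {h}⟩ (fun _ => False) fun _ _ => False := by
  have hnot : ∀ v, ¬ Search.Done ⟨h, table, Function.update (fun _ => ⊤) h 0, {h}⟩ v := by
    rintro v ⟨h1, h2⟩
    have hv : v ≠ h := fun he => h2 (Finset.mem_singleton.2 he)
    simp [hv] at h1
  refine ⟨hs, hcomp, hcard, by simp, by simp, ?_, ?_, fun v _ => hfresh v,
    fun v hv => absurd hv (hnot v), fun v _ hv => absurd hv (hnot v),
    fun v _ hv => absurd hv (hnot v)⟩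
  · intro v
    by_cases hv : v = h
    · subst hv
      simp [weightedDist_self]
    · simp [Function.update_of_ne hv]
  · intro v hd
    refine Or.inl ?_
    by_contra hv
    simp only at hv
    simp [hv] at hd

theorem SearchInv.pop [Finite V]
    (I : SearchInv G wt R complete B L r (fun _ => False) fun _ _ => False) {v : V} {d : ℝ≥0}
    (mem : v ∈ r.heap) (dist_eq : r.dist v = d) (least : ∀ u ∈ r.heap, r.dist v ≤ r.dist u) :
    SearchInv G wt R complete B L { r with heap := r.heap.erase v } (fun x => x = v)
        (fun _ _ => False) ∧
      Search.Current G wt R { r with heap := r.heap.erase v } v d := by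
  have hdone : ∀ x, Search.Done { r with heap := r.heap.erase v } x → r.Done x ∨ x = v := by
    rintro x ⟨h1, h2⟩
    by_cases hx : x = v
    · exact Or.inr hx
    · exact Or.inl ⟨h1, fun hm => h2 (Finset.mem_erase.2 ⟨hx, hm⟩)⟩
  constructor
  · refine
      { I with
        heap_dist := fun x hx => I.heap_dist x (Finset.mem_of_mem_erase hx)
        fresh := ?_
        labelled := fun x h1 h2 => I.labelled x ((hdone x h1).resolve_right h2) id
        relaxed := fun x y h1 h2 => I.relaxed x y ((hdone x h1).resolve_right h2) id
        mono := ?_ }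
    · rintro x (hx | hx | hx)
      · exact I.fresh x (Or.inl hx)
      · exact I.fresh x (Or.inr (Or.inl (Finset.mem_of_mem_erase hx)))
      · exact I.fresh x (Or.inr (Or.inl (by rw [hx]; exact mem)))
    · intro x y hx hy
      rcases hdone x hx with h | h
      · exact I.mono x y h (Finset.mem_of_mem_erase hy)
      · exact h ▸ least y (Finset.mem_of_mem_erase hy)
  · refine ⟨dist_eq, Finset.notMem_erase v _, ?_, ?_⟩
    · intro x hx
      rcases hdone x hx with h | h
      · exact dist_eq ▸ I.mono x v h mem
      · exact (h ▸ dist_eq).le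
    · intro hc
      rcases I.done_or_exists_heap_le hc with h | ⟨y, hy, hle⟩
      · exact absurd mem h.2
      · exact le_antisymm (dist_eq ▸ (least y hy).trans hle) (dist_eq ▸ I.dist_sound v)

theorem SearchInv.insertLabel {v : V} {d : ℝ≥0}
    (I : SearchInv G wt R complete B L r (fun x => x = v) fun _ _ => False)
    (hcur : r.Current G wt R v d) {l : List V} (hl : ∀ u, G.Adj v u → u ∈ l) :
    SearchInv G wt R complete B (Function.update L v (L v ++ [(r.root, d)])) r (fun _ => False)
      fun z z' => z = v ∧ z' ∈ l := by
  refine { I with fresh := ?_, labelled := ?_, relaxed := ?_ }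
  · intro x hx e
    have hxv : x ≠ v := by
      rintro rfl
      rcases hx with h | h | h
      · exact hcur.done.1 h
      · exact hcur.notMem_heap h
      · exact h
    rw [Function.update_of_ne hxv]
    exact I.fresh x (hx.imp_right fun h => h.imp_right False.elim) e
  · intro x h1 _ h3
    by_cases hxv : x = v
    · subst hxv
      exact ⟨d, by simp, hcur.exact_of_canonical h3⟩
    · rw [Function.update_of_ne hxv]
      exact I.labelled x h1 hxv h3
  · intro z z' h1 _ h3 h4 h5
    have hzv : z ≠ v := by
      rintro rfl
      exact h5 ⟨rfl, hl z' h4⟩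
    exact I.relaxed z z' h1 hzv h3 h4 id

theorem Search.done_relax_iff {u : V} {c : ℝ≥0} (hu : ¬ r.Done u) (x : V) :
    Search.Done { r with dist := Function.update r.dist u (c : ℝ≥0∞), heap := insert u r.heap } x ↔
      r.Done x := by
  by_cases hx : x = u
  · subst hx
    simp only [hu, iff_false]
    exact fun h => h.2 (Finset.mem_insert_self x r.heap)
  · simp [Search.Done, hx]

theorem SearchInv.relax {v u : V} {d : ℝ≥0} {rest : List V}
    (I : SearchInv G wt R complete B L r (fun _ => False) fun z z' => z = v ∧ z' ∈ u :: rest)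
    (hcur : r.Current G wt R v d) (hv : R v ≤ R r.root) (hadj : G.Adj v u)
    (shorter : ((d + wt s(v, u) : ℝ≥0) : ℝ≥0∞) < r.dist u) :
    SearchInv G wt R complete B L
        { r with
          dist := Function.update r.dist u ((d + wt s(v, u) : ℝ≥0) : ℝ≥0∞)
          heap := insert u r.heap } (fun _ => False) (fun z z' => z = v ∧ z' ∈ rest) ∧
      Search.Current G wt R
        { r with
          dist := Function.update r.dist u ((d + wt s(v, u) : ℝ≥0) : ℝ≥0∞)
          heap := insert u r.heap } v d := by
  have hu : ¬ r.Done u := hcur.not_done_of_lt shorter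
  have hdone := Search.done_relax_iff (c := d + wt s(v, u)) hu
  have hne : ∀ x, r.Done x → x ≠ u := fun x hx he => hu (he ▸ hx)
  have hle : ∀ x, Function.update r.dist u ((d + wt s(v, u) : ℝ≥0) : ℝ≥0∞) x ≤ r.dist x := by
    intro x
    by_cases hx : x = u
    · subst hx
      simpa using shorter.le
    · rw [Function.update_of_ne hx]
  have hlow : LowReach G R r.root v := I.lowReach hcur.done.1 hv
  constructor
  · refine
      { I with
        dist_root := (hle _).trans I.dist_root
        heap_dist := ?_
        dist_sound := ?_
        linked := ?_
        fresh := ?_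
        labelled := fun x h1 => I.labelled x ((hdone x).1 h1)
        relaxed := ?_
        mono := ?_ }
    · intro x hx
      dsimp only at hx ⊢
      by_cases hxu : x = u
      · subst hxu
        rw [Function.update_self]
        exact ENNReal.coe_ne_top
      · rw [Function.update_of_ne hxu]
        exact I.heap_dist x ((Finset.mem_insert.1 hx).resolve_left hxu)
    · intro x
      dsimp only
      by_cases hxu : x = u
      · subst hxu
        rw [Function.update_self, ENNReal.coe_add]
        exact (weightedDist_triangle _ v _).trans
          (add_le_add (hcur.dist_eq ▸ I.dist_sound v) (weightedDist_le_of_adj hadj))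
      · rw [Function.update_of_ne hxu]
        exact I.dist_sound x
    · intro x hx
      dsimp only at hx ⊢
      by_cases hxu : x = u
      · exact Or.inr ⟨v, hlow, hxu ▸ hadj⟩
      · rw [Function.update_of_ne hxu] at hx
        exact I.linked x hx
    · intro x hx
      dsimp only at hx ⊢
      by_cases hxu : x = u
      · subst hxu
        refine I.fresh x ?_
        by_cases h : r.dist x = ⊤
        · exact Or.inl h
        · exact Or.inr (Or.inl (by_contra fun h' => hu ⟨h, h'⟩))
      · refine I.fresh x ?_
        rw [Function.update_of_ne hxu] at hx
        exact hx.imp_right fun h => h.imp_left fun h' =>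
          (Finset.mem_insert.1 h').resolve_left hxu
    · intro z z' h1 _ h3 h4 h5
      have hz := (hdone z).1 h1
      dsimp only at h3 ⊢
      by_cases hzu : z = v ∧ z' = u
      · obtain ⟨rfl, rfl⟩ := hzu
        rw [Function.update_self, ENNReal.coe_add, hcur.exact_of_canonical h3]
      · refine (hle z').trans (I.relaxed z z' hz id h3 h4 ?_)
        rintro ⟨rfl, hm⟩
        rcases List.mem_cons.1 hm with h | h
        · exact hzu ⟨rfl, h⟩
        · exact h5 ⟨rfl, h⟩
    · intro x y hx hy
      have hx' := (hdone x).1 hx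
      dsimp only at hy ⊢
      rw [Function.update_of_ne (hne x hx')]
      by_cases hyu : y = u
      · subst hyu
        rw [Function.update_self]
        exact (hcur.done_le x hx').trans (by exact_mod_cast le_self_add)
      · rw [Function.update_of_ne hyu]
        exact I.mono x y hx' ((Finset.mem_insert.1 hy).resolve_left hyu)
  · refine ⟨?_, ?_, ?_, hcur.exact_of_canonical⟩
    · rw [← hcur.dist_eq]
      exact Function.update_of_ne (hne v hcur.done) _ _
    · exact ((hdone v).2 hcur.done).2
    · intro x hx
      have hx' := (hdone x).1 hx
      exact (hle x).trans (hcur.done_le x hx')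

theorem SearchInv.skip {v u : V} {d : ℝ≥0} {rest : List V}
    (I : SearchInv G wt R complete B L r (fun _ => False) fun z z' => z = v ∧ z' ∈ u :: rest)
    (hcur : r.Current G wt R v d) (longer : r.dist u ≤ ((d + wt s(v, u) : ℝ≥0) : ℝ≥0∞)) :
    SearchInv G wt R complete B L r (fun _ => False) fun z z' => z = v ∧ z' ∈ rest := by
  refine { I with relaxed := ?_ }
  intro z z' h1 h2 h3 h4 h5
  by_cases hzu : z = v ∧ z' = u
  · obtain ⟨rfl, rfl⟩ := hzu
    rw [← hcur.exact_of_canonical h3]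
    exact_mod_cast longer
  · refine I.relaxed z z' h1 h2 h3 h4 ?_
    rintro ⟨rfl, hm⟩
    rcases List.mem_cons.1 hm with h | h
    · exact hzu ⟨rfl, h⟩
    · exact h5 ⟨rfl, h⟩

end SearchInvariant

/-! ### The invariant of the label construction -/

section BuildInvariant

variable {V : Type*}

/-- The root of the search that a thread is running. -/
def Thread.root? : Thread V → Option V
  | .idle => none
  | .halted => none
  | .starting h => some h
  | .looping r => some r.root
  | .popped r _ _ => some r.root
  | .querying r _ _ => some r.root
  | .inserting r _ _ => some r.root
  | .relaxing r _ _ _ => some r.root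

/-- Invariant of a thread while the labels are `L`. -/
def ThreadInv (G : SimpleGraph V) (wt : Sym2 V → ℝ≥0) (R : V → ℕ) (rankQueries : Bool) (B : ℕ)
    (L : Labeling V) : Thread V → Prop
  | .idle => True
  | .halted => True
  | .starting h => ∀ v e, (h, e) ∉ L v
  | .looping r =>
    SearchInv G wt R (rankQueries = false) B L r (fun _ => False) fun _ _ => False
  | .popped r v d =>
    SearchInv G wt R (rankQueries = false) B L r (fun x => x = v) (fun _ _ => False) ∧
      r.Current G wt R v d
  | .querying r v d =>
    SearchInv G wt R (rankQueries = false) B L r (fun x => x = v) (fun _ _ => False) ∧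
      r.Current G wt R v d ∧ (rankQueries = true → R v ≤ R r.root)
  | .inserting r v d =>
    SearchInv G wt R (rankQueries = false) B L r (fun x => x = v) (fun _ _ => False) ∧
      r.Current G wt R v d ∧ R v ≤ R r.root
  | .relaxing r v d rest =>
    SearchInv G wt R (rankQueries = false) B L r (fun _ => False) (fun z z' => z = v ∧ z' ∈ rest) ∧
      r.Current G wt R v d ∧ R v ≤ R r.root ∧ ∀ u ∈ rest, G.Adj v u

/-- Invariant of the label construction. In particular the searches in progress have different
roots, and a root whose search is finished (it is neither in the queue nor in progress) is a hub,
with the exact distance, of every vertex of which it is a canonical hub. -/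
structure BuildInv (G : SimpleGraph V) (wt : Sym2 V → ℝ≥0) (R : V → ℕ) (rankQueries : Bool) (B : ℕ)
    {p : ℕ} (s : BuildState V p) : Prop where
  sorted : s.memory.queue.Pairwise fun a b => R b < R a
  above : ∀ x, x ∉ s.memory.queue → ∀ y ∈ s.memory.queue, R y < R x
  nodup : ∀ v, ((s.memory.labels v).map Prod.fst).Nodup
  label : ∀ v h e, (h, e) ∈ s.memory.labels v →
    h ∉ s.memory.queue ∧ LowReach G R h v ∧ weightedDist G wt h v ≤ (e : ℝ≥0)
  active : ∀ i h, (s.thread i).root? = some h → h ∉ s.memory.queue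
  inj : ∀ i j h, (s.thread i).root? = some h → (s.thread j).root? = some h → i = j
  finished : ∀ h, h ∉ s.memory.queue → (∀ i, (s.thread i).root? ≠ some h) →
    ∀ v, Canonical G wt R h v →
      ∃ e : ℝ≥0, (h, e) ∈ s.memory.labels v ∧ (e : ℝ≥0∞) = weightedDist G wt h v
  halted : ∀ i, s.thread i = .halted → s.memory.queue = []
  thread : ∀ i, ThreadInv G wt R rankQueries B s.memory.labels (s.thread i)

variable {G : SimpleGraph V} {wt : Sym2 V → ℝ≥0} {R : V → ℕ} {b : Bool} {B : ℕ}
  {p : ℕ} {s : BuildState V p}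

theorem ThreadInv.congr_labels {L L' : Labeling V} {t : Thread V}
    (I : ThreadInv G wt R b B L t)
    (h : ∀ x, t.root? = some x → ∀ v e, (x, e) ∈ L' v ↔ (x, e) ∈ L v) :
    ThreadInv G wt R b B L' t := by
  cases t with
  | idle => trivial
  | halted => trivial
  | starting x => exact fun v e he => I v e ((h x rfl v e).1 he)
  | looping r => exact SearchInv.congr_labels I (h r.root rfl)
  | popped r v d => exact ⟨I.1.congr_labels (h r.root rfl), I.2⟩
  | querying r v d => exact ⟨I.1.congr_labels (h r.root rfl), I.2⟩
  | inserting r v d => exact ⟨I.1.congr_labels (h r.root rfl), I.2⟩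
  | relaxing r v d rest => exact ⟨I.1.congr_labels (h r.root rfl), I.2⟩

theorem BuildInv.length_le (I : BuildInv G wt R b B s) (H : HubSets G R B) (v : V) :
    (s.memory.labels v).length ≤ B := by
  classical
  rw [← List.length_map Prod.fst, ← List.toFinset_card_of_nodup (I.nodup v)]
  refine (Finset.card_le_card fun h hh => ?_).trans (H.card_le v)
  obtain ⟨⟨h', e⟩, hm, rfl⟩ := List.mem_map.1 (List.mem_toFinset.1 hh)
  exact H.mem_of_lowReach _ _ (I.label v _ _ hm).2.1

/-- Steps of a thread that leave the memory alone and stay in the same search. -/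
theorem BuildInv.update_thread (I : BuildInv G wt R b B s) {i : Fin p} {t : Thread V}
    (hroot : t.root? = (s.thread i).root?) (hhalt : t = .halted → s.memory.queue = [])
    (ht : ThreadInv G wt R b B s.memory.labels t) :
    BuildInv G wt R b B ⟨s.memory, Function.update s.thread i t⟩ := by
  have hroots : ∀ j, (Function.update s.thread i t j).root? = (s.thread j).root? := by
    intro j
    by_cases hj : j = i
    · subst hj
      rw [Function.update_self, hroot]
    · rw [Function.update_of_ne hj]
  refine ⟨I.sorted, I.above, I.nodup, I.label, fun j h hj => I.active j h (hroots j ▸ hj),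
    fun j k h hj hk => I.inj j k h (hroots j ▸ hj) (hroots k ▸ hk),
    fun h h1 h2 => I.finished h h1 fun j hj => h2 j ((hroots j).trans hj), fun j hj => ?_,
    fun j => ?_⟩
  · dsimp only at hj
    by_cases hji : j = i
    · subst hji
      rw [Function.update_self] at hj
      exact hhalt hj
    · rw [Function.update_of_ne hji] at hj
      exact I.halted j hj
  by_cases hj : j = i
  · subst hj
    dsimp only
    rw [Function.update_self]
    exact ht
  · dsimp only
    rw [Function.update_of_ne hj]
    exact I.thread j

theorem BuildInv.take {i : Fin p} {h : V} {q : List V} {L : Labeling V}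
    (I : BuildInv G wt R b B s) (hs : s.memory = ⟨h :: q, L⟩) (hi : s.thread i = .idle) :
    BuildInv G wt R b B ⟨⟨q, L⟩, Function.update s.thread i (.starting h)⟩ := by
  have hsorted := I.sorted
  have habove := I.above
  have hnodup := I.nodup
  have hlabel := I.label
  have hactive := I.active
  have hfin := I.finished
  have hthread := I.thread
  have hhalted := I.halted
  rw [hs] at hsorted habove hnodup hlabel hactive hfin hthread hhalted
  dsimp only at hsorted habove hnodup hlabel hactive hfin hthread hhalted
  rw [List.pairwise_cons] at hsorted
  have hhq : h ∉ q := fun hm => (hsorted.1 h hm).false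
  have hself : Thread.root? (Function.update s.thread i (.starting h) i) = some h := by
    rw [Function.update_self]
    rfl
  have hother : ∀ j x, (Function.update s.thread i (.starting h) j).root? = some x →
      (j = i ∧ x = h) ∨ (j ≠ i ∧ (s.thread j).root? = some x ∧ x ≠ h) := by
    intro j x hx
    by_cases hj : j = i
    · subst hj
      exact Or.inl ⟨rfl, Option.some.inj (hx.symm.trans hself)⟩
    · rw [Function.update_of_ne hj] at hx
      exact Or.inr ⟨hj, hx, fun he => hactive j x hx (he ▸ List.mem_cons_self)⟩
  refine ⟨hsorted.2, ?_, hnodup, ?_, ?_, ?_, ?_, ?_, ?_⟩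
  · intro x hx y hy
    by_cases hxh : x = h
    · exact hxh ▸ hsorted.1 y hy
    · refine habove x (fun hm => ?_) y (List.mem_cons_of_mem _ hy)
      exact (List.mem_cons.1 hm).elim hxh hx
  · intro v x e hx
    obtain ⟨h1, h2⟩ := hlabel v x e hx
    exact ⟨fun hm => h1 (List.mem_cons_of_mem _ hm), h2⟩
  · intro j x hj
    rcases hother j x hj with ⟨-, rfl⟩ | ⟨-, h1, -⟩
    · exact hhq
    · exact fun hm => hactive j x h1 (List.mem_cons_of_mem _ hm)
  · intro j k x hj hk
    rcases hother j x hj with ⟨rfl, rfl⟩ | ⟨-, h1, h2⟩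
    · rcases hother k x hk with ⟨rfl, -⟩ | ⟨-, -, h3⟩
      · rfl
      · exact absurd rfl h3
    · rcases hother k x hk with ⟨-, rfl⟩ | ⟨-, h3, -⟩
      · exact absurd rfl h2
      · exact I.inj j k x h1 h3
  · intro x hx hno
    have hxh : x ≠ h := fun he => hno i (he ▸ hself)
    refine hfin x (fun hm => (List.mem_cons.1 hm).elim hxh hx) fun j hj => ?_
    by_cases hji : j = i
    · rw [hji, hi] at hj
      cases hj
    · exact hno j (by dsimp only; rw [Function.update_of_ne hji]; exact hj)
  · intro j hj
    dsimp only at hj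
    by_cases hji : j = i
    · subst hji
      rw [Function.update_self] at hj
      cases hj
    · rw [Function.update_of_ne hji] at hj
      cases hhalted j hj
  · intro j
    dsimp only
    by_cases hji : j = i
    · subst hji
      rw [Function.update_self]
      exact fun v e he => (hlabel v h e he).1 List.mem_cons_self
    · rw [Function.update_of_ne hji]
      exact hthread j

theorem BuildInv.finish [Finite V] {i : Fin p} {r : Search V}
    (I : BuildInv G wt R b B s) (hi : s.thread i = .looping r) (hr : r.heap = ∅) :
    BuildInv G wt R b B ⟨s.memory, Function.update s.thread i .idle⟩ := by
  have hother : ∀ j x, (Function.update s.thread i .idle j).root? = some x →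
      (s.thread j).root? = some x := by
    intro j x hx
    by_cases hj : j = i
    · subst hj
      rw [Function.update_self] at hx
      cases hx
    · rwa [Function.update_of_ne hj] at hx
  refine ⟨I.sorted, I.above, I.nodup, I.label, fun j x hj => I.active j x (hother j x hj),
    fun j k x hj hk => I.inj j k x (hother j x hj) (hother k x hk), ?_, ?_, ?_⟩
  · intro x hx hno v hc
    by_cases hxr : x = r.root
    · subst hxr
      have hI : SearchInv G wt R (b = false) B s.memory.labels r (fun _ => False)
          (fun _ _ => False) := by
        have := I.thread i
        rwa [hi] at this
      rcases hI.done_or_exists_heap_le hc with h | ⟨y, hy, -⟩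
      · exact hI.labelled v h id hc
      · rw [hr] at hy
        exact absurd hy (Finset.notMem_empty y)
    · refine I.finished x hx (fun j hj => ?_) v hc
      by_cases hji : j = i
      · rw [hji, hi] at hj
        exact hxr (Option.some.inj hj).symm
      · exact hno j (by dsimp only; rw [Function.update_of_ne hji]; exact hj)
  · intro j hj
    dsimp only at hj
    by_cases hji : j = i
    · subst hji
      rw [Function.update_self] at hj
      cases hj
    · rw [Function.update_of_ne hji] at hj
      exact I.halted j hj
  · intro j
    dsimp only
    by_cases hji : j = i
    · subst hji
      rw [Function.update_self]
      trivial
    · rw [Function.update_of_ne hji]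
      exact I.thread j

/-- If all vertices that are ranked higher than the root of the only search have been searched,
they are hubs wherever they are canonical. -/
theorem BuildInv.finished_of_lt (I : BuildInv G wt R b B s) (hp : Subsingleton (Fin p))
    {i : Fin p} {h x : V} (hi : (s.thread i).root? = some h) (hx : R h < R x) {v : V}
    (hc : Canonical G wt R x v) :
    ∃ e : ℝ≥0, (x, e) ∈ s.memory.labels v ∧ (e : ℝ≥0∞) = weightedDist G wt x v := by
  refine I.finished x (fun hm => ?_) (fun j hj => ?_) v hc
  · exact (I.above h (I.active i h hi) x hm).not_gt hx
  · rw [Subsingleton.elim j i, hi] at hj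
    exact hx.ne (congrArg R (Option.some.inj hj))

section Start

variable [Fintype V]

theorem mem_rankOrder (R : V → ℕ) (v : V) : v ∈ rankOrder R := by
  simp [rankOrder]

theorem pairwise_rankOrder (hR : Function.Injective R) :
    (rankOrder R).Pairwise fun a b => R b < R a := by
  have h1 : (rankOrder R).Pairwise fun a b => decide (R b ≤ R a) = true :=
    List.pairwise_mergeSort (by simp only [decide_eq_true_eq]; intros; omega)
      (by simp only [Bool.or_eq_true, decide_eq_true_eq]; intros; omega) _
  have h2 : (rankOrder R).Nodup :=
    (List.mergeSort_perm _ _).nodup_iff.2 (Finset.nodup_toList _)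
  refine (h1.and h2).imp fun {a b} h => ?_
  exact lt_of_le_of_ne (by simpa using h.1) fun he => h.2 (hR he).symm

theorem BuildInv.start (hR : Function.Injective R) :
    BuildInv G wt R b B (BuildState.start R p) where
  sorted := pairwise_rankOrder hR
  above x hx := absurd (mem_rankOrder R x) hx
  nodup v := List.nodup_nil
  label v h e hm := absurd hm List.not_mem_nil
  active i h hi := by cases hi
  inj i j h hi := by cases hi
  finished h hh := absurd (mem_rankOrder R h) hh
  halted i hi := by cases hi
  thread i := trivial

end Start

/-- After the label construction all canonical hubs are labels with the exact distance. -/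
theorem BuildInv.exists_label_of_final (I : BuildInv G wt R b B s) (hp : 0 < p) (hs : s.Final)
    {h v : V} (hc : Canonical G wt R h v) :
    ∃ e : ℝ≥0, (h, e) ∈ s.memory.labels v ∧ (e : ℝ≥0∞) = weightedDist G wt h v :=
  I.finished h (by simp [I.halted ⟨0, hp⟩ (hs _)])
    (fun i hi => by rw [hs i] at hi; cases hi) v hc

variable [DecidableEq V]

theorem BuildInv.start_search (hR : Function.Injective R) (hp : b = false → Subsingleton (Fin p))
    (I : BuildInv G wt R b B s) (H : HubSets G R B) {i : Fin p} {h : V}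
    (hi : s.thread i = .starting h) :
    ThreadInv G wt R b B s.memory.labels
      (.looping ⟨h, hashLabels (s.memory.labels h), Function.update (fun _ => ⊤) h 0, {h}⟩) := by
  have hroot : (s.thread i).root? = some h := by
    rw [hi]
    rfl
  have hfresh : ∀ v e, (h, e) ∉ s.memory.labels v := by
    have := I.thread i
    rwa [hi] at this
  refine SearchInv.start ?_ ?_ ((ncard_hashLabels_le _).trans (I.length_le H h)) hfresh
  · intro x e hx
    have hm := mem_of_hashLabels_eq_some hx
    obtain ⟨-, h1, h2⟩ := I.label h x e hm
    refine ⟨lt_of_le_of_ne h1.rank_le fun he => ?_, h2⟩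
    exact hfresh h e (hR he ▸ hm)
  · intro hb x hx hc
    obtain ⟨e, he, he'⟩ := I.finished_of_lt (hp hb) hroot hx hc
    exact ⟨e, hashLabels_eq_some (I.nodup h) he, he'⟩

theorem BuildInv.insertLabel {i : Fin p} {r : Search V} {v : V} {d : ℝ≥0} {l : List V}
    (I : BuildInv G wt R b B s) (hi : s.thread i = .inserting r v d)
    (hl : ∀ u, u ∈ l ↔ G.Adj v u) :
    BuildInv G wt R b B
      ⟨{ s.memory with
          labels := Function.update s.memory.labels v (s.memory.labels v ++ [(r.root, d)]) },
        Function.update s.thread i (.relaxing r v d l)⟩ := by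
  have hI : SearchInv G wt R (b = false) B s.memory.labels r (fun x => x = v) (fun _ _ => False) ∧
      r.Current G wt R v d ∧ R v ≤ R r.root := by
    have := I.thread i
    rwa [hi] at this
  obtain ⟨hS, hcur, hRv⟩ := hI
  have hroots : ∀ j, (Function.update s.thread i (.relaxing r v d l) j).root? =
      (s.thread j).root? := by
    intro j
    by_cases hj : j = i
    · subst hj
      rw [Function.update_self, hi]
      rfl
    · rw [Function.update_of_ne hj]
  have hiroot : (s.thread i).root? = some r.root := by
    rw [hi]
    rfl
  have hmem : ∀ x h e, (h, e) ∈ Function.update s.memory.labels v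
      (s.memory.labels v ++ [(r.root, d)]) x ↔
        (h, e) ∈ s.memory.labels x ∨ (x = v ∧ h = r.root ∧ e = d) := by
    intro x h e
    by_cases hx : x = v
    · subst hx
      rw [Function.update_self, List.mem_append, List.mem_singleton, Prod.mk.injEq]
      simp
    · rw [Function.update_of_ne hx]
      simp [hx]
  refine ⟨I.sorted, I.above, ?_, ?_, fun j h hj => I.active j h (hroots j ▸ hj),
    fun j k h hj hk => I.inj j k h (hroots j ▸ hj) (hroots k ▸ hk), ?_, ?_, ?_⟩
  · intro x
    dsimp only
    by_cases hx : x = v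
    · subst hx
      rw [Function.update_self, List.map_append, List.map_singleton]
      refine (I.nodup x).append (List.nodup_singleton _) ?_
      rw [List.disjoint_singleton]
      intro hm
      obtain ⟨⟨h, e⟩, h1, h2⟩ := List.mem_map.1 hm
      dsimp only at h2
      subst h2
      exact hS.fresh x (Or.inr (Or.inr rfl)) e h1
    · rw [Function.update_of_ne hx]
      exact I.nodup x
  · intro x h e hx
    rcases (hmem x h e).1 hx with hx | ⟨rfl, rfl, rfl⟩
    · exact I.label x h e hx
    · exact ⟨I.active i _ hiroot, hS.lowReach hcur.done.1 hRv, hcur.dist_eq ▸ hS.dist_sound x⟩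
  · intro h h1 h2 x hc
    obtain ⟨e, he, he'⟩ := I.finished h h1 (fun j hj => h2 j ((hroots j).trans hj)) x hc
    exact ⟨e, (hmem x h e).2 (Or.inl he), he'⟩
  · intro j hj
    dsimp only at hj
    by_cases hji : j = i
    · subst hji
      rw [Function.update_self] at hj
      cases hj
    · rw [Function.update_of_ne hji] at hj
      exact I.halted j hj
  · intro j
    dsimp only
    by_cases hj : j = i
    · subst hj
      rw [Function.update_self]
      exact ⟨hS.insertLabel hcur fun u hu => (hl u).2 hu, hcur, hRv, fun u hu => (hl u).1 hu⟩
    · rw [Function.update_of_ne hj]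
      refine (I.thread j).congr_labels fun x hx y e => ?_
      rw [hmem]
      refine or_iff_left ?_
      rintro ⟨-, rfl, -⟩
      exact hj (I.inj j i _ hx hiroot)

variable [Fintype V] [DecidableRel G.Adj]

theorem BuildInv.step (hR : Function.Injective R) (hp : b = false → Subsingleton (Fin p))
    (H : HubSets G R B) (I : BuildInv G wt R b B s) {c : ℕ} {s' : BuildState V p}
    (h : BuildStep G wt R b s c s') : BuildInv G wt R b B s' := by
  obtain ⟨i, c, M, t, h⟩ := h
  have hI := I.thread i
  obtain ⟨mem, thr⟩ := s
  dsimp only at h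
  generalize hm : mem = m at h
  generalize hti : thr i = ti at h
  dsimp only at hm hti hI
  cases h with
  | halt L =>
    subst hm
    exact I.update_thread (congrArg Thread.root? hti).symm (fun _ => rfl) trivial
  | take h q L => exact I.take hm hti
  | start M h =>
    subst hm
    exact I.update_thread (congrArg Thread.root? hti).symm nofun (I.start_search hR hp H hti)
  | finish M r empty =>
    subst hm
    exact I.finish hti empty
  | pop M r v d mem dist_eq least =>
    subst hm
    rw [hti] at hI
    exact I.update_thread (congrArg Thread.root? hti).symm nofun
      (SearchInv.pop hI mem dist_eq least)
  | rankPrune M r v d prune =>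
    subst hm
    rw [hti] at hI
    exact I.update_thread (congrArg Thread.root? hti).symm nofun
      (hI.1.prune fun hc => hc.rank_le.not_gt prune.2)
  | rankPass M r v d pass =>
    subst hm
    rw [hti] at hI
    exact I.update_thread (congrArg Thread.root? hti).symm nofun
      ⟨hI.1, hI.2, fun hb => not_lt.1 fun hlt => pass ⟨hb, hlt⟩⟩
  | query M r v d =>
    subst hm
    rw [hti] at hI
    have hroot : Thread.root? (thr i) = some r.root := by
      rw [hti]
      rfl
    split_ifs with hq
    · refine I.update_thread hroot.symm nofun (hI.1.prune ?_)
      exact hI.1.not_canonical_of_distQuery hI.2.1 (fun x e hx => (I.label v x e hx).2.2) hq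
    · refine I.update_thread hroot.symm nofun ⟨hI.1, hI.2.1, ?_⟩
      cases hb : b with
      | true => exact hI.2.2 hb
      | false =>
        by_contra hlt
        exact hq (hI.1.distQuery_eq_true hb hI.2.1
          (fun x hx hc => I.finished_of_lt (hp hb) hroot hx hc) (not_le.1 hlt))
  | insert M r v d =>
    subst hm
    exact I.insertLabel hti (by simp)
  | relax M r v d u rest shorter =>
    subst hm
    rw [hti] at hI
    obtain ⟨h1, h2, h3, h4⟩ := hI
    obtain ⟨h5, h6⟩ := h1.relax h2 h3 (h4 u List.mem_cons_self) shorter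
    exact I.update_thread (congrArg Thread.root? hti).symm nofun
      ⟨h5, h6, h3, fun x hx => h4 x (List.mem_cons_of_mem _ hx)⟩
  | skip M r v d u rest longer =>
    subst hm
    rw [hti] at hI
    obtain ⟨h1, h2, h3, h4⟩ := hI
    exact I.update_thread (congrArg Thread.root? hti).symm nofun
      ⟨h1.skip h2 longer, h2, h3, fun x hx => h4 x (List.mem_cons_of_mem _ hx)⟩
  | relaxed M r v d =>
    subst hm
    rw [hti] at hI
    refine I.update_thread (congrArg Thread.root? hti).symm nofun ?_
    simpa [ThreadInv] using hI.1

end BuildInvariant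

/-! ### Executions bounded by a potential -/

section Potential

variable {σ : Type*} {step : σ → ℕ → σ → Prop}

theorem Exec.head {s t u : σ} {c c' : ℕ} (h : step s c t) (h' : Exec step t c' u) :
    ∃ c'', Exec step s c'' u := by
  induction h' with
  | refl => exact ⟨_, Exec.tail (.refl s) h⟩
  | tail _ h2 ih =>
    obtain ⟨d, hd⟩ := ih
    exact ⟨_, hd.tail h2⟩

theorem Exec.inv_and_potential_le {Inv : σ → Prop} {Φ : σ → ℕ}
    (hstep : ∀ t c t', Inv t → step t c t' → Inv t' ∧ c + Φ t' ≤ Φ t) {s t : σ} {c : ℕ}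
    (hs : Inv s) (h : Exec step s c t) : Inv t ∧ c + Φ t ≤ Φ s := by
  induction h with
  | refl => exact ⟨hs, by omega⟩
  | tail _ h' ih =>
    obtain ⟨h1, h2⟩ := ih
    obtain ⟨h3, h4⟩ := hstep _ _ _ h1 h'
    exact ⟨h3, by omega⟩

/-- A potential that pays for every step bounds the work; since every step costs something and only
final states have no successor, every execution can be completed. -/
theorem runsWithin_of_potential {final : σ → Prop} {Inv : σ → Prop} {Φ : σ → ℕ}
    (hstep : ∀ t c t', Inv t → step t c t' → Inv t' ∧ c + Φ t' ≤ Φ t)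
    (hpos : ∀ t c t', Inv t → step t c t' → 0 < c)
    (hprog : ∀ t, Inv t → final t ∨ ∃ c t', step t c t') {s : σ} (hs : Inv s) {setup : ℕ} {W : ℝ}
    (hW : ((setup + Φ s : ℕ) : ℝ) ≤ W) : RunsWithin step final setup s W := by
  intro c t h
  obtain ⟨ht, hc⟩ := h.inv_and_potential_le hstep hs
  refine ⟨le_trans (by exact_mod_cast (by omega)) hW, ?_⟩
  clear h hc
  induction hk : Φ t using Nat.strong_induction_on generalizing t with
  | _ k ih =>
  rcases hprog t ht with hf | ⟨d, t', h'⟩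
  · exact ⟨0, t, .refl t, hf⟩
  · obtain ⟨h1, h2⟩ := hstep _ _ _ ht h'
    have h3 := hpos _ _ _ ht h'
    obtain ⟨c', u, h4, h5⟩ := ih (Φ t') (by omega) t' h1 rfl
    obtain ⟨c'', h6⟩ := Exec.head h' h4
    exact ⟨c'', u, h6, h5⟩

/-- The effect of changing one value on a sum over all indices. -/
theorem sum_update_add {α β : Type*} [Fintype α] [DecidableEq α] (g : β → ℕ) (f : α → β) (i : α)
    (x : β) : ∑ j, g (Function.update f i x j) + g (f i) = ∑ j, g (f j) + g x := by
  rw [← Finset.add_sum_erase _ _ (Finset.mem_univ i),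
    ← Finset.add_sum_erase _ (fun j => g (f j)) (Finset.mem_univ i), Function.update_self]
  have h : ∑ j ∈ Finset.univ.erase i, g (Function.update f i x j) =
      ∑ j ∈ Finset.univ.erase i, g (f j) :=
    Finset.sum_congr rfl fun j hj => by rw [Function.update_of_ne (Finset.ne_of_mem_erase hj)]
  rw [h]
  ring

end Potential

/-! ### The work of the label construction -/

section BuildWork

variable {V : Type*} [Fintype V] [DecidableEq V] {G : SimpleGraph V}
  {wt : Sym2 V → ℝ≥0} {R : V → ℕ} {b : Bool} {B : ℕ} {p : ℕ}

/-- The vertices that a search from `h` may pop. -/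
def HubSets.popSet (H : HubSets G R B) (h : V) : Finset V :=
  Finset.univ.filter fun v => h ∈ H.A v ∨ v ∈ H.A h

theorem log_card_le {V : Type*} [Fintype V] (s : Finset V) :
    Nat.log 2 s.card ≤ Nat.log 2 (Fintype.card V) :=
  Nat.log_mono_right (Finset.card_le_univ s)

theorem SearchInv.mem_popSet {complete : Prop} {L : Labeling V} {r : Search V} {pend : V → Prop}
    {todo : V → V → Prop} (I : SearchInv G wt R complete B L r pend todo) (H : HubSets G R B)
    {v : V} (hv : r.dist v ≠ ⊤) : v ∈ H.popSet r.root := by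
  refine Finset.mem_filter.2 ⟨Finset.mem_univ v, ?_⟩
  rcases I.linked v hv with h | ⟨x, hx, hxv⟩
  · rw [h]
    exact Or.inl (H.mem_of_lowReach _ _ .refl)
  · exact H.mem_of_adj _ x v hx hxv

/-- Each of the pairs of a root and a vertex that may be popped is accounted for by a hub set. -/
theorem HubSets.sum_card_popSet_le (H : HubSets G R B) :
    ∑ h, (H.popSet h).card ≤ 2 * (Fintype.card V * B) := by
  have h1 : ∀ h, (H.popSet h).card ≤
      (Finset.univ.filter fun v => h ∈ H.A v).card + (H.A h).card := by
    intro h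
    rw [HubSets.popSet, Finset.filter_or]
    refine (Finset.card_union_le _ _).trans (add_le_add_right ?_ _)
    simp
  have h2 : ∑ h, (Finset.univ.filter fun v => h ∈ H.A v).card = ∑ v, (H.A v).card := by
    simp only [Finset.card_filter]
    rw [Finset.sum_comm]
    simp
  have h3 : ∑ v, (H.A v).card ≤ Fintype.card V * B := by
    simpa using Finset.sum_le_card_nsmul Finset.univ _ B fun v _ => H.card_le v
  have h4 := Finset.sum_le_sum fun h (_ : h ∈ Finset.univ) => h1 h
  rw [Finset.sum_add_distrib, h2] at h4
  omega

variable [DecidableRel G.Adj]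

/-- Work for labelling `v` and relaxing its edges in a search from `h`. -/
def HubSets.labelCost (H : HubSets G R B) (h v : V) : ℕ :=
  if h ∈ H.A v then 2 + G.degree v * (2 + Nat.log 2 (Fintype.card V)) else 0

/-- Work for popping and querying `v`, and then labelling it if that is possible. -/
def HubSets.vertexCost (H : HubSets G R B) (h v : V) : ℕ :=
  2 + Nat.log 2 (Fintype.card V) + 1 + (B + 1) + H.labelCost h v

/-- Work for resetting the tables after a search from `h`. -/
def HubSets.finishCost (H : HubSets G R B) (h : V) : ℕ :=
  1 + (H.popSet h).card + B

/-- Work of a whole search from `h`. -/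
def HubSets.searchCost (H : HubSets G R B) (h : V) : ℕ :=
  2 + B + H.finishCost h + ∑ v ∈ H.popSet h, H.vertexCost h v

open Classical in
/-- Work of the rest of a search: resetting the tables, and the vertices that have not been popped
yet. One more unit is kept for the final step in which the thread halts. -/
def HubSets.restCost (H : HubSets G R B) (r : Search V) : ℕ :=
  1 + H.finishCost r.root +
    ∑ v ∈ (H.popSet r.root).filter fun v => ¬ r.Done v, H.vertexCost r.root v

/-- Work that a thread may still do before it takes the next root. -/
def HubSets.threadCost (H : HubSets G R B) : Thread V → ℕ
  | .idle => 1
  | .halted => 0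
  | .starting h => 1 + H.searchCost h
  | .looping r => H.restCost r
  | .popped r v _ => H.restCost r + 1 + (B + 1) + H.labelCost r.root v
  | .querying r v _ => H.restCost r + (B + 1) + H.labelCost r.root v
  | .inserting r v _ => H.restCost r + H.labelCost r.root v
  | .relaxing r _ _ rest =>
    H.restCost r + 1 + rest.length * (2 + Nat.log 2 (Fintype.card V))

/-- Bound for the work that is still to be done in the label construction; taking a root from the
queue costs one unit besides its search. -/
def HubSets.buildCost (H : HubSets G R B) (s : BuildState V p) : ℕ :=
  (s.memory.queue.map fun h => 1 + H.searchCost h).sum + ∑ i, H.threadCost (s.thread i)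

theorem HubSets.restCost_pop (H : HubSets G R B) {r : Search V} {v : V}
    (hv : v ∈ H.popSet r.root) (hr : v ∈ r.heap) (hd : r.dist v ≠ ⊤) :
    H.restCost { r with heap := r.heap.erase v } + H.vertexCost r.root v ≤ H.restCost r := by
  classical
  have hmem : v ∈ (H.popSet r.root).filter fun v => ¬ r.Done v :=
    Finset.mem_filter.2 ⟨hv, fun h => h.2 hr⟩
  have hsub : ((H.popSet r.root).filter fun x =>
      ¬ Search.Done { r with heap := r.heap.erase v } x) ⊆
        ((H.popSet r.root).filter fun v => ¬ r.Done v).erase v := by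
    intro x hx
    rw [Finset.mem_filter] at hx
    have hxv : x ≠ v := by
      rintro rfl
      exact hx.2 ⟨hd, Finset.notMem_erase x _⟩
    refine Finset.mem_erase.2 ⟨hxv, Finset.mem_filter.2 ⟨hx.1, fun h => hx.2 ⟨h.1, ?_⟩⟩⟩
    exact fun h' => h.2 (Finset.mem_of_mem_erase h')
  have h1 := Finset.sum_le_sum_of_subset (f := H.vertexCost r.root) hsub
  have h2 := Finset.sum_erase_add _ (H.vertexCost r.root) hmem
  unfold HubSets.restCost
  dsimp only
  convert_to _ ≤ 1 + H.finishCost r.root +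
    ∑ v ∈ (H.popSet r.root).filter fun v => ¬ r.Done v, H.vertexCost r.root v
  convert_to 1 + H.finishCost r.root + ∑ v ∈ (H.popSet r.root).filter fun x =>
      ¬ Search.Done { r with heap := r.heap.erase v } x, H.vertexCost r.root v +
      H.vertexCost r.root v ≤ _
  omega

/-- Relaxing an edge does not change which vertices have been popped. -/
theorem HubSets.restCost_relax (H : HubSets G R B) {r : Search V} {u : V} {c : ℝ≥0}
    (hu : ¬ r.Done u) :
    H.restCost { r with
      dist := Function.update r.dist u (c : ℝ≥0∞)
      heap := insert u r.heap } = H.restCost r := by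
  classical
  unfold HubSets.restCost
  simp only [Search.done_relax_iff hu]

theorem ThreadStep.work_pos {M M' : Memory V} {t t' : Thread V} {c : ℕ}
    (h : ThreadStep G wt R b M t c M' t') : 0 < c := by
  cases h <;> first | omega | exact one_le_distQuery_snd _ _ _

theorem HubSets.buildCost_update (H : HubSets G R B) {s : BuildState V p} {i : Fin p}
    {M : Memory V} {t : Thread V} {c : ℕ} (hq : M.queue = s.memory.queue)
    (h : c + H.threadCost t ≤ H.threadCost (s.thread i)) :
    c + H.buildCost ⟨M, Function.update s.thread i t⟩ ≤ H.buildCost s := by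
  have h1 := sum_update_add H.threadCost s.thread i t
  unfold HubSets.buildCost
  dsimp only
  rw [hq]
  omega

/-- Every step is paid for by the decrease of the work that is still to be done. -/
theorem BuildInv.buildCost_step {s s' : BuildState V p} (I : BuildInv G wt R b B s)
    (H : HubSets G R B) {c : ℕ} (h : BuildStep G wt R b s c s') :
    c + H.buildCost s' ≤ H.buildCost s := by
  classical
  obtain ⟨i, c, M, t, h⟩ := h
  have hI := I.thread i
  obtain ⟨mem, thr⟩ := s
  dsimp only at h
  generalize hm : mem = m at h
  generalize hti : thr i = ti at h
  dsimp only at hm hti hI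
  cases h with
  | halt L =>
    subst hm
    exact H.buildCost_update rfl (by dsimp only; rw [hti]; simp [HubSets.threadCost])
  | take h q L =>
    subst hm
    have h1 := sum_update_add H.threadCost thr i (.starting h)
    rw [hti] at h1
    unfold HubSets.buildCost
    dsimp only [HubSets.threadCost] at h1 ⊢
    rw [List.map_cons, List.sum_cons]
    omega
  | start M h =>
    subst hm
    refine H.buildCost_update rfl ?_
    dsimp only
    rw [hti]
    dsimp only [HubSets.threadCost, HubSets.restCost, HubSets.searchCost]
    have h1 := I.length_le H h
    dsimp only at h1
    have h2 := Finset.sum_le_sum_of_subset (f := H.vertexCost h)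
      (Finset.filter_subset (fun v => ¬ Search.Done ⟨h, hashLabels (mem.labels h),
        Function.update (fun _ => ⊤) h 0, {h}⟩ v) (H.popSet h))
    omega
  | finish M r empty =>
    subst hm
    rw [hti] at hI
    refine H.buildCost_update rfl ?_
    dsimp only
    rw [hti]
    dsimp only [HubSets.threadCost, HubSets.restCost, HubSets.finishCost]
    have h1 : {v | r.dist v ≠ ⊤}.ncard ≤ (H.popSet r.root).card := by
      rw [← Set.ncard_coe_finset]
      exact Set.ncard_le_ncard (fun v hv => SearchInv.mem_popSet hI H hv) (Finset.finite_toSet _)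
    have h2 := SearchInv.table_card hI
    omega
  | pop M r v d mem dist_eq least =>
    subst hm
    rw [hti] at hI
    refine H.buildCost_update rfl ?_
    dsimp only
    rw [hti]
    dsimp only [HubSets.threadCost]
    have hd := SearchInv.heap_dist hI v mem
    have h1 := H.restCost_pop (SearchInv.mem_popSet hI H hd) mem hd
    have h2 := log_card_le r.heap
    rw [HubSets.vertexCost] at h1
    omega
  | rankPrune M r v d prune =>
    subst hm
    refine H.buildCost_update rfl ?_
    dsimp only
    rw [hti]
    dsimp only [HubSets.threadCost]
    omega
  | rankPass M r v d pass =>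
    subst hm
    refine H.buildCost_update rfl ?_
    dsimp only
    rw [hti]
    dsimp only [HubSets.threadCost]
    omega
  | query M r v d =>
    subst hm
    refine H.buildCost_update rfl ?_
    have h1 := (distQuery_snd_le r.table d (mem.labels v)).trans
      (Nat.succ_le_succ (I.length_le H v))
    dsimp only
    rw [hti]
    split_ifs
    · dsimp only [HubSets.threadCost]
      omega
    · dsimp only [HubSets.threadCost]
      omega
  | insert M r v d =>
    subst hm
    rw [hti] at hI
    refine H.buildCost_update rfl ?_
    dsimp only
    rw [hti]
    dsimp only [HubSets.threadCost]
    have h1 : r.root ∈ H.A v :=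
      H.mem_of_lowReach _ _ (hI.1.lowReach hI.2.1.done.1 hI.2.2)
    rw [HubSets.labelCost, if_pos h1, Finset.length_toList,
      SimpleGraph.card_neighborFinset_eq_degree]
    omega
  | relax M r v d u rest shorter =>
    subst hm
    rw [hti] at hI
    refine H.buildCost_update rfl ?_
    dsimp only
    rw [hti]
    dsimp only [HubSets.threadCost]
    rw [H.restCost_relax (hI.2.1.not_done_of_lt shorter), List.length_cons, Nat.succ_mul]
    have h2 := log_card_le (insert u r.heap)
    omega
  | skip M r v d u rest longer =>
    subst hm
    refine H.buildCost_update rfl ?_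
    dsimp only
    rw [hti]
    dsimp only [HubSets.threadCost]
    rw [List.length_cons, Nat.succ_mul]
    omega
  | relaxed M r v d =>
    subst hm
    refine H.buildCost_update rfl ?_
    dsimp only
    rw [hti]
    dsimp only [HubSets.threadCost]
    omega

/-- The label construction never gets stuck. -/
theorem BuildInv.final_or_exists_step {s : BuildState V p} (I : BuildInv G wt R b B s) :
    s.Final ∨ ∃ c s', BuildStep G wt R b s c s' := by
  by_cases hf : s.Final
  · exact Or.inl hf
  refine Or.inr ?_
  unfold BuildState.Final at hf
  push Not at hf
  obtain ⟨i, hi⟩ := hf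
  suffices h : ∃ c M t, ThreadStep G wt R b s.memory (s.thread i) c M t by
    obtain ⟨c, M, t, h⟩ := h
    exact ⟨c, _, .mk s i c M t h⟩
  have hI := I.thread i
  obtain ⟨⟨queue, L⟩, thr⟩ := s
  dsimp only at hi hI ⊢
  generalize thr i = t at hi hI ⊢
  cases t with
  | idle =>
    cases queue with
    | nil => exact ⟨_, _, _, .halt L⟩
    | cons h q => exact ⟨_, _, _, .take h q L⟩
  | halted => exact absurd rfl hi
  | starting h => exact ⟨_, _, _, .start _ h⟩
  | looping r =>
    by_cases hr : r.heap = ∅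
    · exact ⟨_, _, _, .finish _ r hr⟩
    · obtain ⟨v, hv, hmin⟩ :=
        r.heap.exists_min_image r.dist (Finset.nonempty_iff_ne_empty.2 hr)
      exact ⟨_, _, _, .pop _ r v (r.dist v).toNNReal hv
        (ENNReal.coe_toNNReal (SearchInv.heap_dist hI v hv)).symm hmin⟩
  | popped r v d =>
    by_cases hb : b = true ∧ R r.root < R v
    · exact ⟨_, _, _, .rankPrune _ r v d hb⟩
    · exact ⟨_, _, _, .rankPass _ r v d hb⟩
  | querying r v d => exact ⟨_, _, _, .query _ r v d⟩
  | inserting r v d => exact ⟨_, _, _, .insert _ r v d⟩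
  | relaxing r v d rest =>
    cases rest with
    | nil => exact ⟨_, _, _, .relaxed _ r v d⟩
    | cons u rest =>
      rcases lt_or_ge ((d + wt s(v, u) : ℝ≥0) : ℝ≥0∞) (r.dist u) with h | h
      · exact ⟨_, _, _, .relax _ r v d u rest h⟩
      · exact ⟨_, _, _, .skip _ r v d u rest h⟩

/-! ### Summing up the work -/

/-- By double counting, `v` pays for its degree once for each of its at most `B` potential hubs. -/
theorem HubSets.sum_labelCost_le (H : HubSets G R B) :
    ∑ h, ∑ v ∈ H.popSet h, H.labelCost h v ≤
      B * (2 * Fintype.card V +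
        2 * G.edgeFinset.card * (2 + Nat.log 2 (Fintype.card V))) := by
  calc ∑ h, ∑ v ∈ H.popSet h, H.labelCost h v
      ≤ ∑ h, ∑ v, H.labelCost h v :=
        Finset.sum_le_sum fun h _ => Finset.sum_le_sum_of_subset (Finset.subset_univ _)
    _ = ∑ v, ∑ h, H.labelCost h v := Finset.sum_comm
    _ ≤ ∑ v, B * (2 + G.degree v * (2 + Nat.log 2 (Fintype.card V))) := by
        refine Finset.sum_le_sum fun v _ => ?_
        simp only [HubSets.labelCost]
        rw [← Finset.sum_filter]
        simp only [Finset.filter_univ_mem, Finset.sum_const, smul_eq_mul]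
        exact Nat.mul_le_mul_right _ (H.card_le v)
    _ = _ := by
        rw [← Finset.mul_sum, Finset.sum_add_distrib, ← Finset.sum_mul,
          G.sum_degrees_eq_twice_card_edges]
        simp [mul_comm]

/-- The distance queries cost `O(n B²)`, the relaxations `O(m B log n)`, and as `log n = O(B)` all
else is absorbed by the former term; the constants are crude. -/
theorem HubSets.buildCost_start_le (H : HubSets G R B) (hB : Nat.log 2 (Fintype.card V) + 1 ≤ B)
    (hp : p ≤ Fintype.card V) :
    H.buildCost (BuildState.start R p) ≤ 23 * (Fintype.card V * B ^ 2) +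
      4 * (G.edgeFinset.card * (B * (Nat.log 2 (Fintype.card V) + 1))) := by
  have h1 := H.sum_card_popSet_le
  have h2 := H.sum_labelCost_le
  set n := Fintype.card V with hn
  set l := Nat.log 2 n with hl
  set m := G.edgeFinset.card with hm
  have h3 : ((rankOrder R).map fun h => 1 + H.searchCost h).sum = ∑ h, (1 + H.searchCost h) := by
    have hperm : (rankOrder R).Perm (Finset.univ : Finset V).toList := List.mergeSort_perm _ _
    rw [(hperm.map _).sum_eq, Finset.sum_map_toList]
  have h4 : ∑ h, (1 + H.searchCost h) = n * (4 + 2 * B) +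
      (∑ h, (H.popSet h).card) * (l + B + 5) + ∑ h, ∑ v ∈ H.popSet h, H.labelCost h v := by
    simp only [HubSets.searchCost, HubSets.finishCost, HubSets.vertexCost,
      Finset.sum_add_distrib, Finset.sum_const, smul_eq_mul, Finset.card_univ, Finset.sum_mul]
    rw [← Finset.sum_mul, ← Finset.sum_mul, ← Finset.sum_mul, ← Finset.sum_mul, ← Finset.sum_mul]
    ring
  have h5 : H.buildCost (BuildState.start R p) =
      ((rankOrder R).map fun h => 1 + H.searchCost h).sum + p := by
    simp [HubSets.buildCost, BuildState.start, HubSets.threadCost]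
  rw [h5, h3, h4]
  have h6 := Nat.mul_le_mul_right (l + B + 5) h1
  have h7 : 1 ≤ B := by omega
  have h8 : n ≤ n * B ^ 2 := Nat.le_mul_of_pos_right _ (by positivity)
  have h9 : n * B ≤ n * B ^ 2 := Nat.mul_le_mul_left _ (by nlinarith)
  have h10 : n * B * l ≤ n * B ^ 2 := by
    rw [mul_assoc]
    exact Nat.mul_le_mul_left _ (by nlinarith)
  have h11 : m * (B * 1) ≤ m * (B * (l + 1)) := by gcongr; omega
  nlinarith

end BuildWork

/-! ### Label cleaning -/

section Cleaning

variable {V : Type*} {G : SimpleGraph V} {wt : Sym2 V → ℝ≥0} {R : V → ℕ} {B : ℕ}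
  {s : CleanState V}

/-- The labels of `v` in `l` whose hub is canonical carry the exact distance. -/
def CanonicalExact (G : SimpleGraph V) (wt : Sym2 V → ℝ≥0) (R : V → ℕ) (v : V)
    (l : List (V × ℝ≥0)) : Prop :=
  ∀ h (e : ℝ≥0), (h, e) ∈ l → Canonical G wt R h v → (e : ℝ≥0∞) = weightedDist G wt h v

/-- Invariant of the cleaning loop of `v`: a label is never deleted if its hub is canonical. -/
def CleanerInv (G : SimpleGraph V) (wt : Sym2 V → ℝ≥0) (R : V → ℕ) (v : V) : Cleaner V → Prop
  | .scan l => CanonicalExact G wt R v l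
  | .erase h l => ¬ Canonical G wt R h v ∧ CanonicalExact G wt R v l

/-- Invariant of the label cleaning. -/
structure CleanInv (G : SimpleGraph V) (wt : Sym2 V → ℝ≥0) (R : V → ℕ) (B : ℕ)
    (s : CleanState V) : Prop where
  length_le : ∀ v, (s.labels v).length ≤ B
  sorted : ∀ v, (s.labels v).Pairwise fun a b => R b.1 < R a.1
  sound : ∀ v h (e : ℝ≥0), (h, e) ∈ s.labels v → weightedDist G wt h v ≤ e
  canonical : ∀ v h, Canonical G wt R h v →
    ∃ e : ℝ≥0, (h, e) ∈ s.labels v ∧ (e : ℝ≥0∞) = weightedDist G wt h v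
  cleaner : ∀ v, CleanerInv G wt R v (s.cleaner v)

theorem mem_sortLabels {L : Labeling V} {v : V} {a : V × ℝ≥0} :
    a ∈ sortLabels R L v ↔ a ∈ L v :=
  List.mem_mergeSort

theorem pairwise_sortLabels (hR : Function.Injective R) {L : Labeling V} {v : V}
    (hL : ((L v).map Prod.fst).Nodup) :
    (sortLabels R L v).Pairwise fun a b => R b.1 < R a.1 := by
  have h1 : (sortLabels R L v).Pairwise fun a b => decide (R b.1 ≤ R a.1) = true :=
    List.pairwise_mergeSort (by simp only [decide_eq_true_eq]; intros; omega)
      (by simp only [Bool.or_eq_true, decide_eq_true_eq]; intros; omega) _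
  have h2 : ((sortLabels R L v).map Prod.fst).Nodup :=
    ((List.mergeSort_perm _ _).map _).nodup_iff.2 hL
  refine (h1.and (List.pairwise_map.1 h2)).imp fun {a b} h => ?_
  exact lt_of_le_of_ne (by simpa using h.1) fun he => h.2 (hR he).symm

theorem BuildInv.cleanInv_start (hR : Function.Injective R) {b : Bool} {p : ℕ}
    {s : BuildState V p} (I : BuildInv G wt R b B s) (H : HubSets G R B) (hp : 0 < p)
    (hs : s.Final) : CleanInv G wt R B (CleanState.start R s.memory.labels) where
  length_le v := (List.length_mergeSort _).trans_le (I.length_le H v)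
  sorted v := pairwise_sortLabels hR (I.nodup v)
  sound v h e hm := (I.label v h e (mem_sortLabels.1 hm)).2.2
  canonical v h hc := by
    obtain ⟨e, he, he'⟩ := I.exists_label_of_final hp hs hc
    exact ⟨e, mem_sortLabels.2 he, he'⟩
  cleaner v := by
    intro h e hm hc
    obtain ⟨e', he, he'⟩ := I.exists_label_of_final hp hs hc
    rw [← he', label_unique (I.nodup v) (mem_sortLabels.1 hm) he]

theorem CanonicalExact.of_cons {v : V} {a : V × ℝ≥0} {l : List (V × ℝ≥0)}
    (h : CanonicalExact G wt R v (a :: l)) : CanonicalExact G wt R v l :=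
  fun x e hm hc => h x e (List.mem_cons_of_mem _ hm) hc

/-- Bound for the work that is still to be done by the cleaning loop of a vertex: a check costs at
most `2 * B + 2` and the deletion that may follow at most `B + 1`. -/
def cleanerCost (B : ℕ) : Cleaner V → ℕ
  | .scan l => l.length * (3 * B + 3)
  | .erase _ l => B + 1 + l.length * (3 * B + 3)

/-- Bound for the work that is still to be done in the label cleaning. -/
def cleanCost [Fintype V] (B : ℕ) (s : CleanState V) : ℕ :=
  ∑ v, cleanerCost B (s.cleaner v)

variable [DecidableEq V]

theorem CleanInv.step (I : CleanInv G wt R B s) {c : ℕ} {s' : CleanState V}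
    (h : CleanStep R s c s') : CleanInv G wt R B s' := by
  cases h with
  | check v h δ l at_v =>
    refine { I with cleaner := fun x => ?_ }
    dsimp only
    by_cases hx : x = v
    · subst hx
      have hex : CanonicalExact G wt R x ((h, δ) :: l) := by
        have := I.cleaner x
        rwa [at_v] at this
      rw [Function.update_self]
      split_ifs with hq
      · refine ⟨fun hc => ?_, hex.of_cons⟩
        -- a common hub of higher rank would be on a shortest path from `h`
        obtain ⟨a, da, db, h1, h2, h3, h4⟩ := exists_of_cleanQuery_eq_true R hq
        refine (hc.2 a ?_).not_gt h4
        rw [← hex h δ List.mem_cons_self hc, weightedDist_comm h a]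
        exact (add_le_add (I.sound h a da h1) (I.sound x a db h2)).trans (by exact_mod_cast h3)
      · exact hex.of_cons
    · rw [Function.update_of_ne hx]
      exact I.cleaner x
  | erase v h l at_v =>
    have hinv : ¬ Canonical G wt R h v ∧ CanonicalExact G wt R v l := by
      have := I.cleaner v
      rwa [at_v] at this
    have hsub : ∀ x, (Function.update s.labels v ((s.labels v).filter fun a => a.1 ≠ h) x).Sublist
        (s.labels x) := by
      intro x
      by_cases hx : x = v
      · subst hx
        rw [Function.update_self]
        exact List.filter_sublist
      · rw [Function.update_of_ne hx]
    refine ⟨fun x => (hsub x).length_le.trans (I.length_le x),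
      fun x => (I.sorted x).sublist (hsub x),
      fun x a e hm => I.sound x a e ((hsub x).subset hm), fun x a hc => ?_, fun x => ?_⟩
    · obtain ⟨e, he, he'⟩ := I.canonical x a hc
      refine ⟨e, ?_, he'⟩
      dsimp only
      by_cases hx : x = v
      · subst hx
        rw [Function.update_self, List.mem_filter]
        refine ⟨he, ?_⟩
        simp only [ne_eq, decide_eq_true_eq]
        rintro rfl
        exact hinv.1 hc
      · rwa [Function.update_of_ne hx]
    · dsimp only
      by_cases hx : x = v
      · subst hx
        rw [Function.update_self]
        exact hinv.2
      · rw [Function.update_of_ne hx]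
        exact I.cleaner x

theorem CleanStep.work_pos {s s' : CleanState V} {c : ℕ} (h : CleanStep R s c s') : 0 < c := by
  cases h <;> omega

theorem CleanState.final_or_exists_step (R : V → ℕ) (s : CleanState V) :
    s.Final ∨ ∃ c s', CleanStep R s c s' := by
  by_cases hf : s.Final
  · exact Or.inl hf
  refine Or.inr ?_
  unfold CleanState.Final at hf
  push Not at hf
  obtain ⟨v, hv⟩ := hf
  cases hc : s.cleaner v with
  | scan l =>
    cases l with
    | nil => exact absurd hc hv
    | cons a l => exact ⟨_, _, .check s v a.1 a.2 l hc⟩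
  | erase h l => exact ⟨_, _, .erase s v h l hc⟩

/-- Merging the final label sets gives the distance: no common hub gives less, and the canonical
hub on the shortest paths is a common hub. -/
theorem CleanInv.ppsdQuery_fst [Finite V] (hR : Function.Injective R) (I : CleanInv G wt R B s)
    (u v : V) : (ppsdQuery R (s.labels u) (s.labels v)).1 = weightedDist G wt u v := by
  refine le_antisymm ?_ (le_ppsdQuery R fun a da db h1 h2 => ?_)
  · by_cases h : weightedDist G wt u v = ⊤
    · rw [h]
      exact le_top
    · obtain ⟨x, hxu, hxv, -, -, hx⟩ := exists_canonical_hub (R := R) h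
      obtain ⟨e, he, he'⟩ := I.canonical u x hxu
      obtain ⟨e₂, he₂, he₂'⟩ := I.canonical v x hxv
      refine (ppsdQuery_le R hR (I.sorted u) (I.sorted v) he he₂).trans ?_
      rw [ENNReal.coe_add, he', he₂', weightedDist_comm x u, hx]
  · rw [ENNReal.coe_add]
    exact (weightedDist_triangle u a v).trans
      (add_le_add (weightedDist_comm u a ▸ I.sound u a da h1) (I.sound v a db h2))

theorem CleanInv.ppsdQuery_snd_le (I : CleanInv G wt R B s) (u v : V) :
    (ppsdQuery R (s.labels u) (s.labels v)).2 ≤ 2 * B + 1 := by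
  have h1 := HubLabeling.ppsdQuery_snd_le R (s.labels u) (s.labels v)
  have h2 := I.length_le u
  have h3 := I.length_le v
  omega

variable [Fintype V]

theorem CleanInv.cleanCost_step {s s' : CleanState V} (I : CleanInv G wt R B s) {c : ℕ}
    (h : CleanStep R s c s') : c + cleanCost B s' ≤ cleanCost B s := by
  cases h with
  | check v h δ l at_v =>
    have h1 := sum_update_add (cleanerCost B) s.cleaner v
      (if (cleanQuery R h δ (s.labels h) (s.labels v)).1 then .erase h l else .scan l)
    have h2 := cleanQuery_snd_le R h δ (s.labels h) (s.labels v)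
    have h3 := I.length_le h
    have h4 := I.length_le v
    have h5 : cleanerCost B (if (cleanQuery R h δ (s.labels h) (s.labels v)).1 then
        Cleaner.erase h l else .scan l) ≤ B + 1 + l.length * (3 * B + 3) := by
      split_ifs
      · exact le_rfl
      · exact Nat.le_add_left _ _
    rw [at_v] at h1
    unfold cleanCost
    dsimp only
    have h6 : cleanerCost B (.scan ((h, δ) :: l)) = l.length * (3 * B + 3) + (3 * B + 3) := by
      rw [cleanerCost, List.length_cons, Nat.succ_mul]
    omega
  | erase v h l at_v =>
    have h1 := sum_update_add (cleanerCost B) s.cleaner v (.scan l)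
    have h4 := I.length_le v
    rw [at_v] at h1
    unfold cleanCost
    dsimp only [cleanerCost] at h1 ⊢
    omega

end Cleaning

/-! ### LCC and sequential PLL -/

section Algorithms

variable {V : Type*} [Fintype V] {G : SimpleGraph V}
  {wt : Sym2 V → ℝ≥0} {R : V → ℕ} {B : ℕ} {p : ℕ}

/-- Bound for the work of sorting and cleaning label sets of at most `B` labels. -/
def cleaningBudget (V : Type*) [Fintype V] (B : ℕ) : ℕ :=
  Fintype.card V * (2 + B * (1 + B)) + Fintype.card V * (B * (3 * B + 3))

/-- Invariant of LCC. -/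
def LCCInv (G : SimpleGraph V) (wt : Sym2 V → ℝ≥0) (R : V → ℕ) (B : ℕ) : LCCState V p → Prop
  | .constructing s => BuildInv G wt R true B s
  | .cleaning s => CleanInv G wt R B s

theorem LCCInv.start (hR : Function.Injective R) : LCCInv G wt R B (LCCState.start R p) :=
  BuildInv.start (b := true) hR

theorem sortWork_add_cleanCost_le {L : Labeling V} (hL : ∀ v, (L v).length ≤ B) :
    sortWork L + cleanCost B (CleanState.start R L) ≤ cleaningBudget V B := by
  refine add_le_add ?_ ?_
  · refine (Finset.sum_le_card_nsmul Finset.univ _ (2 + B * (1 + B)) fun v _ => ?_).trans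
      (by simp)
    have h1 := hL v
    have h2 : Nat.log 2 (L v).length ≤ B := (Nat.log_le_self 2 _).trans h1
    gcongr
  · refine (Finset.sum_le_card_nsmul Finset.univ _ (B * (3 * B + 3)) fun v _ => ?_).trans
      (by simp)
    exact Nat.mul_le_mul_right _ ((List.length_mergeSort _).trans_le (hL v))

theorem LCCInv.labelCount_le {s : LCCState V p} (I : LCCInv G wt R B s) (H : HubSets G R B) :
    labelCount s.labels ≤ Fintype.card V * B := by
  refine (Finset.sum_le_card_nsmul Finset.univ _ B fun v _ => ?_).trans (by simp)
  cases s with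
  | constructing s => exact BuildInv.length_le I H v
  | cleaning s => exact CleanInv.length_le I v

variable [DecidableEq V] [DecidableRel G.Adj]

/-- Bound for the work that LCC still has to do. -/
def HubSets.lccCost (H : HubSets G R B) : LCCState V p → ℕ
  | .constructing s => H.buildCost s + cleaningBudget V B
  | .cleaning s => cleanCost B s

theorem LCCInv.step (hR : Function.Injective R) (H : HubSets G R B) (hp : 0 < p)
    (s : LCCState V p) (c : ℕ) (s' : LCCState V p) (I : LCCInv G wt R B s)
    (h : LCCStep G wt R s c s') :
    LCCInv G wt R B s' ∧ c + H.lccCost s' ≤ H.lccCost s := by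
  cases h with
  | build s s' c h =>
    refine ⟨BuildInv.step hR (by simp) H I h, ?_⟩
    have := BuildInv.buildCost_step I H h
    dsimp only [HubSets.lccCost]
    omega
  | sort s h =>
    refine ⟨BuildInv.cleanInv_start hR I H hp h, ?_⟩
    have := sortWork_add_cleanCost_le (R := R) (BuildInv.length_le I H)
    dsimp only [HubSets.lccCost]
    omega
  | clean s s' c h => exact ⟨CleanInv.step I h, CleanInv.cleanCost_step I h⟩

theorem LCCStep.work_pos [Nonempty V] {s s' : LCCState V p} {c : ℕ} (h : LCCStep G wt R s c s') :
    0 < c := by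
  cases h with
  | build s s' c h =>
    obtain ⟨i, c, M, t, h⟩ := h
    exact h.work_pos
  | sort s h => exact Finset.sum_pos (fun v _ => by omega) Finset.univ_nonempty
  | clean s s' c h => exact h.work_pos

theorem LCCInv.final_or_exists_step {s : LCCState V p} (I : LCCInv G wt R B s) :
    s.Final ∨ ∃ c s', LCCStep G wt R s c s' := by
  cases s with
  | constructing s =>
    refine Or.inr ?_
    rcases BuildInv.final_or_exists_step I with h | ⟨c, s', h⟩
    · exact ⟨_, _, .sort s h⟩
    · exact ⟨_, _, .build s s' c h⟩
  | cleaning s =>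
    rcases CleanState.final_or_exists_step R s with h | ⟨c, s', h⟩
    · exact Or.inl h
    · exact Or.inr ⟨_, _, .clean s s' c h⟩

theorem LCCReaches.inv (hR : Function.Injective R) (H : HubSets G R B) (hp : 0 < p)
    {s : LCCState V p} (h : LCCReaches G wt R p s) : LCCInv G wt R B s := by
  obtain ⟨c, h⟩ := h
  exact (h.inv_and_potential_le (Inv := LCCInv G wt R B) (Φ := H.lccCost) (LCCInv.step hR H hp)
    (LCCInv.start hR)).1

/-- The sum of all work, in terms of the number `n` of vertices, the number `m` of edges and the
bound `B` for the size of the label sets. -/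
theorem HubSets.total_le (H : HubSets G R B) (hB : Nat.log 2 (Fintype.card V) + 1 ≤ B)
    (hp : p ≤ Fintype.card V) :
    setupWork V + (H.buildCost (BuildState.start R p) + cleaningBudget V B) ≤
      35 * (Fintype.card V * B ^ 2) +
        4 * (G.edgeFinset.card * (B * (Nat.log 2 (Fintype.card V) + 1))) := by
  have h1 := H.buildCost_start_le hB hp
  unfold setupWork cleaningBudget
  set n := Fintype.card V
  have h7 : 1 ≤ B := by omega
  have h8 : n ≤ n * B ^ 2 := Nat.le_mul_of_pos_right _ (by positivity)
  have h9 : n * B ≤ n * B ^ 2 := Nat.mul_le_mul_left _ (by nlinarith)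
  have h10 : n * (1 + Nat.log 2 n) ≤ n * B := Nat.mul_le_mul_left _ (by omega)
  have h11 : n * (2 + B * (1 + B)) + n * (B * (3 * B + 3)) =
      2 * n + 4 * (n * B) + 4 * (n * B ^ 2) := by ring
  omega

theorem lccRunsWithin [Nonempty V] (hR : Function.Injective R) (H : HubSets G R B)
    (hB : Nat.log 2 (Fintype.card V) + 1 ≤ B) (hp : 0 < p) (hpn : p ≤ Fintype.card V) {W : ℝ}
    (hW : ((35 * (Fintype.card V * B ^ 2) +
      4 * (G.edgeFinset.card * (B * (Nat.log 2 (Fintype.card V) + 1))) : ℕ) : ℝ) ≤ W) :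
    LCCRunsWithin G wt R p W :=
  runsWithin_of_potential (Inv := LCCInv G wt R B) (Φ := H.lccCost) (LCCInv.step hR H hp)
    (fun _ _ _ _ h => h.work_pos) (fun _ I => I.final_or_exists_step) (LCCInv.start hR)
    (le_trans (by exact_mod_cast H.total_le hB hpn) hW)

theorem pllRunsWithin [Nonempty V] (hR : Function.Injective R) (H : HubSets G R B)
    (hB : Nat.log 2 (Fintype.card V) + 1 ≤ B) {W : ℝ}
    (hW : ((35 * (Fintype.card V * B ^ 2) +
      4 * (G.edgeFinset.card * (B * (Nat.log 2 (Fintype.card V) + 1))) : ℕ) : ℝ) ≤ W) :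
    PLLRunsWithin G wt R W := by
  refine runsWithin_of_potential (Inv := BuildInv G wt R false B) (Φ := H.buildCost)
    (fun s c s' I h => ⟨I.step hR (fun _ => inferInstance) H h, I.buildCost_step H h⟩)
    ?_ (fun _ I => I.final_or_exists_step) (BuildInv.start hR) (le_trans ?_ hW)
  · rintro s c s' - ⟨i, c, M, t, h⟩
    exact h.work_pos
  · have h := H.total_le (p := 1) hB Fintype.card_pos
    exact_mod_cast (by omega : _ ≤ _)

end Algorithms

/-! ### The bounds in terms of tree-width -/

/-- A bag that contains the two ends of an edge has at least two vertices. -/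
theorem one_le_treewidth {V : Type*} [Fintype V] {G : SimpleGraph V} (h : G.edgeSet.Nonempty) :
    1 ≤ treewidth G := by
  classical
  obtain ⟨N, D, hD⟩ := exists_treeDecomposition_width_eq_treewidth G
  obtain ⟨e, he⟩ := h
  induction e using Sym2.ind with
  | _ u v =>
  rw [SimpleGraph.mem_edgeSet] at he
  obtain ⟨t, hu, hv⟩ := D.exists_edge_bag u v he
  have h1 : ({u, v} : Finset V).card ≤ (D.bag t).card :=
    Finset.card_le_card (by simp [Finset.insert_subset_iff, hu, hv])
  rw [Finset.card_pair he.ne] at h1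
  have h2 := Finset.le_sup (f := fun t => (D.bag t).card) (Finset.mem_univ t)
  rw [← hD, TreeDecomposition.width]
  omega

end HubLabeling

end

theorem mainTheorem3 (K : ℕ) :
    ∃ C : ℝ, 0 < C ∧
      ∀ (V : Type*) [Fintype V] [DecidableEq V] (G : SimpleGraph V) [DecidableRel G.Adj]
        (wt : Sym2 V → ℝ≥0), (∀ e ∈ G.edgeSet, 0 < wt e) → G.edgeSet.Nonempty →
        (∃ R : V → ℕ, HubLabeling.IsCentroidRanking G 1 R) ∧
        ∀ R : V → ℕ, HubLabeling.IsCentroidRanking G K R →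
          (∀ p : ℕ, 1 ≤ p → p ≤ Fintype.card V →
            HubLabeling.LCCRunsWithin G wt R p (C * HubLabeling.workBound G) ∧
            (∀ s : HubLabeling.LCCState V p, HubLabeling.LCCReaches G wt R p s →
              (HubLabeling.labelCount s.labels : ℝ) ≤
                C * ((HubLabeling.treewidth G : ℝ) * (Fintype.card V : ℝ) *
                  Real.log (Fintype.card V))) ∧
            (∀ s : HubLabeling.LCCState V p, HubLabeling.LCCReaches G wt R p s → s.Final →
              ∀ u v : V,
                (HubLabeling.ppsdQuery R (s.labels u) (s.labels v)).1 =
                  HubLabeling.weightedDist G wt u v ∧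
                ((HubLabeling.ppsdQuery R (s.labels u) (s.labels v)).2 : ℝ) ≤
                  C * ((HubLabeling.treewidth G : ℝ) * Real.log (Fintype.card V)))) ∧
          HubLabeling.PLLRunsWithin G wt R (C * HubLabeling.workBound G) := by
  have hlog2 : 0 < Real.log 2 := Real.log_pos one_lt_two
  -- `γ log n` bounds `⌊log₂ n⌋ + 1`, and `β w log n` bounds the number `B` of labels of a vertex
  set γ : ℝ := 2 / Real.log 2 with hγ
  have hγ0 : 0 < γ := by positivity
  set β : ℝ := 2 * (K + 1) * γ with hβ
  have hβ0 : 0 < β := by positivity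
  refine ⟨35 * β ^ 2 + 4 * (β * γ) + 3 * β, by positivity, ?_⟩
  intro V _ _ G _ wt _ hedge
  have hcard : 2 ≤ Fintype.card V := by
    obtain ⟨e, he⟩ := hedge
    induction e using Sym2.ind with
    | _ u v => exact Fintype.one_lt_card_iff.2 ⟨u, v, (G.mem_edgeSet.1 he).ne⟩
  have hne : Nonempty V := Fintype.card_pos_iff.1 (by omega)
  refine ⟨HubLabeling.exists_isCentroidRanking G, fun R hRank => ?_⟩
  have hw := HubLabeling.one_le_treewidth hedge
  have hR := hRank.1
  obtain ⟨H⟩ := hRank.exists_hubSets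
  set w := HubLabeling.treewidth G with hwdef
  set l := Nat.log 2 (Fintype.card V) with hl
  set B := (w + 1) * ((K + 1) * (l + 1)) with hBdef
  set lam := Real.log (Fintype.card V) with hlam
  have hlam0 : 0 < lam := Real.log_pos (by exact_mod_cast hcard)
  have hB : l + 1 ≤ B := by
    rw [hBdef, ← mul_assoc]
    exact Nat.le_mul_of_pos_left _ (by positivity)
  have hwR : (1 : ℝ) ≤ w := by exact_mod_cast hw
  have hlR : ((l + 1 : ℕ) : ℝ) ≤ γ * lam := by
    have h1 : (l : ℝ) * Real.log 2 ≤ lam := by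
      have h2 : ((2 ^ l : ℕ) : ℝ) ≤ Fintype.card V := by
        exact_mod_cast Nat.pow_log_le_self 2 (by omega)
      have h3 := Real.log_le_log (by positivity) h2
      rwa [Nat.cast_pow, Real.log_pow, Nat.cast_ofNat] at h3
    have h2 : Real.log 2 ≤ lam := Real.log_le_log (by norm_num) (by exact_mod_cast hcard)
    rw [hγ, div_mul_eq_mul_div, le_div_iff₀ hlog2]
    push_cast
    linarith
  have hBR : (B : ℝ) ≤ β * (w * lam) := by
    have h1 : (B : ℝ) = (w + 1) * ((K + 1) * ((l + 1 : ℕ) : ℝ)) := by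
      rw [hBdef]
      push_cast
      ring
    rw [h1]
    calc ((w : ℝ) + 1) * ((K + 1) * ((l + 1 : ℕ) : ℝ)) ≤ (2 * w) * ((K + 1) * (γ * lam)) := by
          gcongr
          linarith
      _ = β * (w * lam) := by rw [hβ]; ring
  have hB0 : (0 : ℝ) ≤ B := Nat.cast_nonneg B
  have hwork : ((35 * (Fintype.card V * B ^ 2) + 4 * (G.edgeFinset.card * (B * (l + 1))) : ℕ) : ℝ)
      ≤ (35 * β ^ 2 + 4 * (β * γ) + 3 * β) * HubLabeling.workBound G := by
    set n : ℝ := (Fintype.card V : ℝ) with hn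
    set m : ℝ := (G.edgeFinset.card : ℝ) with hm
    have hX : HubLabeling.workBound G = w * m * lam ^ 2 + w ^ 2 * n * lam ^ 2 := rfl
    have hn0 : 0 ≤ n := Nat.cast_nonneg _
    have hm0 : 0 ≤ m := Nat.cast_nonneg _
    have h1 : n * (B : ℝ) ^ 2 ≤ β ^ 2 * (w ^ 2 * n * lam ^ 2) := by
      calc n * (B : ℝ) ^ 2 ≤ n * (β * (w * lam)) ^ 2 := by gcongr
        _ = _ := by ring
    have h2 : m * ((B : ℝ) * ((l + 1 : ℕ) : ℝ)) ≤ β * γ * (w * m * lam ^ 2) := by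
      calc m * ((B : ℝ) * ((l + 1 : ℕ) : ℝ)) ≤ m * (β * (w * lam) * (γ * lam)) := by gcongr
        _ = _ := by ring
    have h3 : 0 ≤ w * m * lam ^ 2 := by positivity
    have h4 : 0 ≤ (w : ℝ) ^ 2 * n * lam ^ 2 := by positivity
    have h5 : (0 : ℝ) ≤ β ^ 2 := by positivity
    have h6 : 0 ≤ β * γ := by positivity
    rw [hX]
    push_cast at h2 ⊢
    nlinarith [mul_nonneg h5 h3, mul_nonneg h6 h4, mul_nonneg hβ0.le h3, mul_nonneg hβ0.le h4]
  have hC : 3 * β ≤ 35 * β ^ 2 + 4 * (β * γ) + 3 * β := by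
    have : 0 ≤ 35 * β ^ 2 + 4 * (β * γ) := by positivity
    linarith
  refine ⟨fun p hp hpn => ⟨HubLabeling.lccRunsWithin hR H hB hp hpn hwork, ?_, ?_⟩,
    HubLabeling.pllRunsWithin hR H hB hwork⟩
  · intro s hs
    have h1 : (HubLabeling.labelCount s.labels : ℝ) ≤ Fintype.card V * B := by
      exact_mod_cast (hs.inv hR H hp).labelCount_le H
    calc (HubLabeling.labelCount s.labels : ℝ) ≤ Fintype.card V * B := h1
      _ ≤ Fintype.card V * (β * (w * lam)) := by gcongr
      _ = β * (w * Fintype.card V * lam) := by ring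
      _ ≤ _ := by
        gcongr
        linarith
  · intro s hs hf u v
    have hI := hs.inv hR H hp
    cases s with
    | constructing s => exact hf.elim
    | cleaning s =>
      refine ⟨HubLabeling.CleanInv.ppsdQuery_fst hR hI u v, ?_⟩
      have h1 : 2 * B + 1 ≤ 3 * B := by omega
      have h2 := (HubLabeling.CleanInv.ppsdQuery_snd_le hI u v).trans h1
      calc ((HubLabeling.ppsdQuery R (s.labels u) (s.labels v)).2 : ℝ) ≤ 3 * B := by
            exact_mod_cast h2
        _ ≤ 3 * (β * (w * lam)) := by gcongr
        _ = 3 * β * (w * lam) := by ring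
        _ ≤ _ := by gcongr
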